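/- Let $H$ be a real Hilbert space, $T>0$ and $\rho\in\,]0,+\infty]$ (with $\frac1{2\rho}=0$ if $\rho=+\infty$). **Notation.** For $S\subset H$ and $x\in S$, the proximal normal cone $N^P(S;x)$ is the set of $\zeta\in H$ for which there are $\sigma\ge 0$, $\eta>0$ with $\langle\zeta,y-x\rangle\le\sigma\|y-x\|^2$ for all $y\in S$ with $\|y-x\|<\eta$. A nonempty closed set $S$ is $\rho$-uniformly prox-regular if $\langle\zeta,x'-x\rangle\le\frac{\|\zeta\|}{2\rho}\|x'-x\|^2$ for all $x,x'\in S$ and $\zeta\in N^P(S;x)$. A map $C\colon[0,T]\rightrightarrows H$ satisfies - $(\mathsf H_1)$ if every $C(t)$ is nonempty, closed, connected and $\rho$-uniformly prox-regular; - $(\mathsf H_2)$ if $C$ is lower semicontinuous on $[0,T]$; - $(\mathsf H_3)$ if for every bounded $x\colon[0,T]\to H$ with $x(t)\in C(t)$ for all $t$ and every $\eta>0$ there is $R_{x,\eta}>0$ such that for every compact $K\subset[0,T]$, every continuous $y\colon K\to H$ with $y(t)\in C(t)$ and $\|y(t)-x(t)\|\le\eta$ on $K$ extends to a continuous $\bar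 y\colon[0,T]\to H$ with $\bar y(t)\in C(t)$ and $\|\bar y(t)\|\le R_{x,\eta}$ for all $t$. An admissible trajectory for $C$ from $x_0$ is a right-continuous map $x\colon[0,T]\to H$ of bounded variation with $x(0)=x_0$ and $x(t)\in C(t)$ for all $t\in[0,T]$; $dx$ is its differential measure ($dx(]s,t])=x(t)-x(s)$ for $s\le t$, $dx(\{0\})=0$) and $|dx|$ the variation of $dx$. For a complete positive Radon measure $\nu$ on $[0,T]$ (the completion of a finite Borel measure), let $\mathcal A_\nu(C)$ be the set of continuous $y\colon[0,T]\to H$ with $y(t)\in C(t)$ for $\nu$-a.e. $t$, and if $dx\ll\nu$ and $v=\frac{dx}{d\nu}$, set $$J_\nu(x;y)=\int_0^T\Big(\langle v,y-x\rangle+\frac{\|v\|}{2\rho}\|y-x\|^2\Big)d\nu .$$ A map $x$ is an *integral solution* of the sweeping process driven by $C$ with $x(0)=x_0$ if it is an admissible trajectory for $C$ from $x_0$ and there is a complete positive Radon measure $\nu$ such that $dx$ has a density $v\in L^1_\nu([0,T];H)$ with respect to $\nu$ and $J_\nu(x;y)\ge0$ for all $y\in\mathcal A_\nu(C)$. It is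 a *solution in the sense of differential measures* if it is such an admissible trajectory and for some $\nu$ the measure $dx$ has a density $v\in L^1_\nu([0,T];H)$ with $v(t)\in -N^P(C(t);x(t))$ for $\nu$-a.e. $t$. **Theorem.** Let $C_n$ ($n\in\mathbb N$) and $C$ satisfy $(\mathsf H_1)$, $(\mathsf H_2)$, $(\mathsf H_3)$ with the same $\rho$, and fix a complete positive Radon measure $\nu$ on $[0,T]$. Assume - (OSC) for every $t\in[0,T]$, if $z_n\in C_n(t)$ for all $n$ and $z_n\to z$ in $H$, then $z\in C(t)$; - (SAP) for every $y\in\mathcal A_\nu(C)$ there are $y_n\in\mathcal A_\nu(C_n)$ with $\sup_{t\in[0,T]}\|y_n(t)-y(t)\|\to0$. For each $n$ let $x_n$ be an admissible trajectory for $C_n$ from a common point $x_0$, with $dx_n\ll\nu$, and let $v_n=\frac{dx_n}{d\nu}$. Assume that $x_n\to x$ uniformly on $[0,T]$ for some $x\colon[0,T]\to H$, that - (a) $(v_n)$ is bounded in $L^p_\nu([0,T];H)$ for some $p\in\,]1,\infty]$, and $|dx_n|\rightharpoonup^*|dx|$, i.e. $\int g\,d|dx_n|\to\int g\,d|dx|$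 for all continuous $g\colon[0,T]\to\mathbb R$; - (b) $\mathcal E^n_\nu(x_n):=\inf_{y\in\mathcal A_\nu(C_n)}J_\nu(x_n;y)\to0$. Then $x$ is an integral solution of the sweeping process driven by $C$ with $x(0)=x_0$, and it is a solution of it in the sense of differential measures. -/

import Mathlib

open MeasureTheory Set Filter Topology
open scoped ENNReal NNReal

noncomputable section

namespace Sweeping

variable {H : Type*} [NormedAddCommGroup H] [InnerProductSpace ℝ H]

/-- The time interval `[0, T]`. -/
abbrev TimeInterval (T : ℝ) : Type := Icc (0 : ℝ) T

instance instCompactIccSpaceTimeInterval (T : ℝ) : CompactIccSpace (TimeInterval T) :=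
  ⟨fun {_ _} => isClosed_Icc.isCompact⟩

/-- The initial time `0 ∈ [0, T]`. -/
def initialTime {T : ℝ} (hT : 0 < T) : TimeInterval T := ⟨0, left_mem_Icc.2 hT.le⟩

/-! ### Proximal normals and uniformly prox-regular sets -/

/-- The proximal subdifferential `∂_P f(x)` of `f : H → ℝ ∪ {+∞}` (empty outside `dom f`). -/
def proximalSubdifferential (f : H → EReal) (x : H) : Set H :=
  {ζ | f x ≠ ⊤ ∧ ∃ σ : ℝ, 0 ≤ σ ∧ ∃ η : ℝ, 0 < η ∧ ∀ y ∈ Metric.ball x η,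
    f x + ((inner ℝ ζ (y - x) - σ * ‖y - x‖ ^ 2 : ℝ) : EReal) ≤ f y}

open Classical in
/-- The indicator function `δ_S` of convex analysis: `0` on `S` and `+∞` elsewhere. -/
def indicatorFun (S : Set H) (x : H) : EReal := if x ∈ S then 0 else ⊤

/-- The proximal normal cone `N^P(S; x) = ∂_P δ_S(x)`. -/
def proximalNormalCone (S : Set H) (x : H) : Set H :=
  proximalSubdifferential (indicatorFun S) x

/-- The proximal normal inequality. -/
theorem mem_proximalNormalCone_iff {S : Set H} {x ζ : H} :
    ζ ∈ proximalNormalCone S x ↔ x ∈ S ∧ ∃ σ : ℝ, 0 ≤ σ ∧ ∃ η : ℝ, 0 < η ∧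
      ∀ y ∈ S, y ∈ Metric.ball x η → inner ℝ ζ (y - x) ≤ σ * ‖y - x‖ ^ 2 := by
  classical
  by_cases hx : x ∈ S
  · simp only [proximalNormalCone, proximalSubdifferential, indicatorFun, hx, if_true,
      mem_ofPred_eq, true_and, zero_add, ne_eq, EReal.zero_ne_top, not_false_eq_true]
    refine exists_congr fun σ => and_congr_right fun _ => exists_congr fun η =>
      and_congr_right fun _ => ⟨fun h y hy hb => ?_, fun h y hb => ?_⟩
    · have := h y hb
      rw [if_pos hy] at this
      have := EReal.coe_nonpos.1 this
      linarith
    · by_cases hy : y ∈ S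
      · rw [if_pos hy]
        exact EReal.coe_nonpos.2 (by linarith [h y hy hb])
      · rw [if_neg hy]
        exact le_top
  · simp [proximalNormalCone, proximalSubdifferential, indicatorFun, hx]

/-- The coefficient `1 / (2ρ)` for `ρ ∈ ]0, +∞]`, equal to `0` when `ρ = +∞`. -/
def halfInv (ρ : ℝ≥0∞) : ℝ := ((2 * ρ)⁻¹).toReal

/-- `S` is nonempty, closed and `ρ`-uniformly prox-regular. -/
def IsProxRegular (ρ : ℝ≥0∞) (S : Set H) : Prop :=
  S.Nonempty ∧ IsClosed S ∧ ∀ x ∈ S, ∀ ζ ∈ proximalNormalCone S x, ∀ x' ∈ S,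
    inner ℝ ζ (x' - x) ≤ halfInv ρ * ‖ζ‖ * ‖x' - x‖ ^ 2

/-! ### Assumptions on the moving set -/

variable {T : ℝ}

/-- Every `C(t)` is nonempty, closed, connected and `ρ`-uniformly prox-regular. -/
def HasProxRegularValues (ρ : ℝ≥0∞) (C : TimeInterval T → Set H) : Prop :=
  ∀ t, IsConnected (C t) ∧ IsProxRegular ρ (C t)

/-- The bounded selection-extension property along bounded (not necessarily continuous)
selections of `C`. -/
def HasSelectionExtension (C : TimeInterval T → Set H) : Prop :=
  ∀ x : TimeInterval T → H, Bornology.IsBounded (range x) → (∀ t, x t ∈ C t) →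
    ∀ η : ℝ, 0 < η → ∃ R : ℝ, 0 < R ∧
      ∀ (K : Set (TimeInterval T)) (y : TimeInterval T → H), IsCompact K → ContinuousOn y K →
        (∀ t ∈ K, y t ∈ C t) → (∀ t ∈ K, ‖y t - x t‖ ≤ η) →
        ∃ z : TimeInterval T → H, Continuous z ∧ (∀ t, z t ∈ C t) ∧ EqOn z y K ∧ ∀ t, ‖z t‖ ≤ R

/-- The standing assumptions on a moving set: prox-regular values, lower semicontinuity in time,
bounded selection extension. -/
structure IsMovingSet (ρ : ℝ≥0∞) (C : TimeInterval T → Set H) : Prop where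
  proxRegular : HasProxRegularValues ρ C
  lowerSemicontinuous : LowerHemicontinuous C
  selectionExtension : HasSelectionExtension C

/-! ### Trajectories and their differential measures

A complete positive Radon measure `ν` on `[0, T]` is given by its restriction to the Borel sets,
which is an arbitrary finite Borel measure. Almost everywhere statements, `Integrable`, `MemLp` and
`eLpNorm` for this restriction refer to almost everywhere strongly measurable functions, and these
are the functions that are strongly measurable up to null sets for the completion. -/

/-- Admissible trajectories for `C` starting at `x₀`: right-continuous, of bounded variation,
with `x(0) = x₀` and `x(t) ∈ C(t)` for all `t` (so that `x₀ ∈ C(0)`). -/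
structure IsAdmissible (hT : 0 < T) (C : TimeInterval T → Set H) (x₀ : H)
    (x : TimeInterval T → H) : Prop where
  rightContinuous : ∀ t, ContinuousWithinAt x (Ici t) t
  boundedVariation : BoundedVariationOn x univ
  initial : x (initialTime hT) = x₀
  mem : ∀ t, x t ∈ C t

open Classical in
/-- The differential (Stieltjes) measure `dx` of a function of bounded variation. If `x` is
right-continuous then `dx(]s, t]) = x(t) - x(s)` for `s ≤ t` and `dx({0}) = 0`. -/
def differentialMeasure [CompleteSpace H] (x : TimeInterval T → H) :
    VectorMeasure (TimeInterval T) H :=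
  if h : BoundedVariationOn x univ then h.vectorMeasure else 0

/-- `v ∈ L¹_ν([0, T]; H)` is a density of `dx` with respect to `ν`, i.e. `dx = v dν`. -/
def IsDensity [CompleteSpace H] (x : TimeInterval T → H) (ν : Measure (TimeInterval T))
    (v : TimeInterval T → H) : Prop :=
  Integrable v ν ∧ differentialMeasure x = ν.withDensityᵥ v

open Classical in
/-- A representative of the density `dx/dν`, which is unique up to `ν`-null sets. -/
def density [CompleteSpace H] (x : TimeInterval T → H) (ν : Measure (TimeInterval T)) :
    TimeInterval T → H :=
  if h : ∃ v, IsDensity x ν v then h.choose else 0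

/-- The class `𝒜_ν` of admissible test trajectories for `C`. -/
def testTrajectories (C : TimeInterval T → Set H) (ν : Measure (TimeInterval T)) :
    Set (TimeInterval T → H) :=
  {y | Continuous y ∧ ∀ᵐ t ∂ν, y t ∈ C t}

/-- `∫₀ᵀ (⟨v, y - x⟩ + ‖v‖ / (2ρ) ‖y - x‖²) dν`. -/
def proxIntegral (ρ : ℝ≥0∞) (ν : Measure (TimeInterval T)) (x v y : TimeInterval T → H) : ℝ :=
  ∫ t, (inner ℝ (v t) (y t - x t) + halfInv ρ * ‖v t‖ * ‖y t - x t‖ ^ 2) ∂ν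

/-- The variational residual `ℰ_ν(x)` associated with `C`, with values in `[-∞, +∞]`. -/
def residual [CompleteSpace H] (ρ : ℝ≥0∞) (C : TimeInterval T → Set H)
    (ν : Measure (TimeInterval T)) (x : TimeInterval T → H) : EReal :=
  ⨅ y ∈ testTrajectories C ν, (proxIntegral ρ ν x (density x ν) y : EReal)

/-! ### The two notions of solution -/

/-- Integral solutions of the sweeping process driven by `C` with initial point `x₀`. -/
def IsIntegralSolution [CompleteSpace H] (hT : 0 < T) (ρ : ℝ≥0∞) (C : TimeInterval T → Set H)
    (x₀ : H) (x : TimeInterval T → H) : Prop :=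
  IsAdmissible hT C x₀ x ∧
    ∃ (ν : Measure (TimeInterval T)) (v : TimeInterval T → H), IsFiniteMeasure ν ∧
      IsDensity x ν v ∧ ∀ y ∈ testTrajectories C ν, 0 ≤ proxIntegral ρ ν x v y

/-- Solutions in the sense of differential measures of the sweeping process driven by `C` with
initial point `x₀`. -/
def IsDifferentialMeasureSolution [CompleteSpace H] (hT : 0 < T) (C : TimeInterval T → Set H)
    (x₀ : H) (x : TimeInterval T → H) : Prop :=
  IsAdmissible hT C x₀ x ∧
    ∃ (ν : Measure (TimeInterval T)) (v : TimeInterval T → H), IsFiniteMeasure ν ∧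
      IsDensity x ν v ∧ ∀ᵐ t ∂ν, -v t ∈ proximalNormalCone (C t) (x t)

/-! ### Convergence assumptions -/

/-- Outer semicontinuity: limits of points of `C_n(t)` belong to `C(t)`. -/
def OuterSemicontinuity (Cn : ℕ → TimeInterval T → Set H) (C : TimeInterval T → Set H) : Prop :=
  ∀ (t : TimeInterval T) (z : ℕ → H) (z' : H), (∀ n, z n ∈ Cn n t) →
    Tendsto z atTop (𝓝 z') → z' ∈ C t

/-- The selection approximation property. -/
def SelectionApproximation (Cn : ℕ → TimeInterval T → Set H) (C : TimeInterval T → Set H)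
    (ν : Measure (TimeInterval T)) : Prop :=
  ∀ y ∈ testTrajectories C ν, ∃ yn : ℕ → TimeInterval T → H,
    (∀ n, yn n ∈ testTrajectories (Cn n) ν) ∧ TendstoUniformly yn y atTop

end Sweeping

end

/-! Put `κ = 1/(2ρ)` and `F_v(f) = ∫ (⟨v, f⟩ + κ‖v‖‖f‖²) dν`. By (SAP) a test trajectory `y` for `C`
is a uniform limit of test trajectories `y_n` for `C_n`, and the residual of `x_n` is at most
`F_{v_n}(y_n - x_n)`. Integral solvability thus reduces to `F_{v_n}(y_n - x_n) → F_v(y - x)`.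

Against a continuous argument the linear part converges because `(v_n)` is bounded in `L¹` and its
primitives `x_n - x₀` converge; the quadratic part is linear in `‖v_n‖`, so weak-* convergence of
`|dx_n|` identifies its limit. The argument `y - x` may jump at atoms of `ν`, but it is a bounded
pointwise limit of continuous functions. Equi-integrability, from the `L^p` bound with `p > 1`,
makes the replacement error small uniformly in `n` (`tendsto_proxFunctional`). It also forces `|dx|
≪ ν`, and Radon-Nikodym in a Hilbert space then provides `v`.

For the normal cone inclusion, selection extension glues a continuous selection `w` on a set of
times to `x` on the complement, up to small measure and with uniform bounds. This localizes the
integral inequality to a.e. time for each `w`; Lusin's theorem for `x` and `v` then gives it for all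
points of `C(t)` at once (`ae_forall_mem_nonneg`). -/

section FiniteVariation

/-! ### Finite variation of Stieltjes vector measures. -/

variable {α : Type*} [LinearOrder α] [DenselyOrdered α] [TopologicalSpace α] [OrderTopology α]
  [SecondCountableTopology α] [CompactIccSpace α] [hα : MeasurableSpace α] [BorelSpace α]
  {E : Type*} [NormedAddCommGroup E] [CompleteSpace E] {f : α → E}

/-- On a linear order with endpoints, the Stieltjes vector measure of a function of bounded
variation has finite variation. -/
theorem BoundedVariationOn.isFiniteMeasure_variation_vectorMeasure
    (hf : BoundedVariationOn f univ) {b t : α} (hb : IsBot b) (ht : IsTop t) :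
    IsFiniteMeasure hf.vectorMeasure.variation := by
  have : Nonempty α := ⟨b⟩
  let μ := (hf.stieltjesFunctionRightLim b).measure
  have : IsFiniteMeasure μ :=
    StieltjesFunction.isFiniteMeasure_of_forall_abs_le
      (C := (eVariationOn f.rightLim univ).toReal) _
      (fun x ↦ variationOnFromTo.abs_le_eVariationOn hf.rightLim)
  let m := AddContent.onIoc f.rightLim
  -- Increments of the right-limit function are dominated by the measure of its variation function,
  -- so the extension `m'` obtained below satisfies `|m'| ≤ μ`.
  have A : ∀ s ∈ {s | ∃ u v, u ≤ v ∧ s = Ioc u v}, ‖m s‖ₑ ≤ μ s := by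
    rintro s ⟨u, v, huv, rfl⟩
    rw [AddContent.onIoc_apply huv]
    simp only [μ, StieltjesFunction.measure_Ioc,
      BoundedVariationOn.stieltjesFunctionRightLim_apply]
    rw [← variationOnFromTo.add hf.rightLim.locallyBoundedVariationOn
      (mem_univ b) (mem_univ u) (mem_univ v)]
    simp only [add_sub_cancel_left, variationOnFromTo, huv, ↓reduceIte, univ_inter]
    rw [ENNReal.ofReal_toReal]; swap
    · exact ((eVariationOn.mono _ (subset_univ _)).trans_lt hf.rightLim.lt_top).ne
    rw [← edist_eq_enorm_sub]
    exact eVariationOn.edist_le _ (by grind) (by grind)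
  have B : hα = MeasurableSpace.generateFrom {s | ∃ u v, u ≤ v ∧ s = Ioc u v} := by
    borelize α
    convert! borel_eq_generateFrom_Ioc_le α using 2
    grind only
  obtain ⟨m', hm', hle⟩ :=
    VectorMeasure.exists_extension_of_isSetSemiring_of_le_measure_of_generateFrom
      IsSetSemiring.Ioc A B
  have hbu : ∀ u v : α, b ∉ Ioc u v := fun u v h => absurd (hb u) (not_le.2 h.1)
  -- Half-open intervals never contain the bottom point `b`, so they determine the measure only up
  -- to an atom there; a Dirac mass corrects it.
  have key : hf.vectorMeasure =
      m' + VectorMeasure.dirac b (hf.vectorMeasure {b} - m' {b}) := by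
    have hIoc : ∀ u v, u ≤ v → hf.vectorMeasure (Ioc u v) =
        (m' + VectorMeasure.dirac b (hf.vectorMeasure {b} - m' {b})) (Ioc u v) := by
      intro u v huv
      rw [_root_.add_apply, VectorMeasure.dirac_apply_of_notMem (hbu u v), add_zero,
        hm' _ ⟨u, v, huv, rfl⟩, AddContent.onIoc_apply huv, hf.vectorMeasure_Ioc huv]
    refine VectorMeasure.ext_of_generateFrom _ ?_ B IsSetSemiring.Ioc.isPiSystem ?_
    · rintro s ⟨u, v, huv, rfl⟩
      exact hIoc u v huv
    · have hU : (univ : Set α) = {b} ∪ Ioc b t := by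
        ext z
        rcases (hb z).eq_or_lt with h | h
        · simp [h]
        · simp [h, ht z]
      have hd : Disjoint ({b} : Set α) (Ioc b t) := by simp
      rw [hU, VectorMeasure.of_union hd (measurableSet_singleton b) measurableSet_Ioc,
        VectorMeasure.of_union hd (measurableSet_singleton b) measurableSet_Ioc,
        hIoc b t (hb t)]
      congr 1
      rw [_root_.add_apply, VectorMeasure.dirac_apply_of_mem (measurableSet_singleton b)
        (mem_singleton b)]
      abel
  have h1 : m'.variation ≤ μ := VectorMeasure.variation_le_of_forall_enorm_le (fun s _ => hle s)
  have : IsFiniteMeasure m'.variation := isFiniteMeasure_of_le _ h1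
  rw [key]
  exact isFiniteMeasure_of_le _ VectorMeasure.variation_add_le

end FiniteVariation

/-! ### Radon-Nikodym for Hilbert-valued measures, by Riesz representation. -/

section RadonNikodym

variable {X : Type*} {mX : MeasurableSpace X} {H : Type*} [NormedAddCommGroup H]
  [InnerProductSpace ℝ H] [CompleteSpace H]

/-- A vector measure of finite variation with values in a Hilbert space has a density with
respect to its variation. -/
theorem MeasureTheory.VectorMeasure.exists_eq_withDensityᵥ_variation (μ : VectorMeasure X H)
    [IsFiniteMeasure μ.variation] :
    ∃ w : X → H, Integrable w μ.variation ∧ μ = μ.variation.withDensityᵥ w := by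
  set lam := μ.variation with hlam
  have hint : ∀ φ : Lp H 2 lam, μ.Integrable φ := fun φ =>
    (Lp.memLp φ).integrable (by norm_num)
  -- Pairing with `dμ` is controlled by the `L¹(|μ|)` norm, hence by the `L²` norm as `|μ|` is
  -- finite. The Riesz representative in `L²(|μ|; H)` is the density.
  let L : Lp H 2 lam →ₗ[ℝ] ℝ :=
    { toFun := fun φ => ∫ᵛ x, φ x ∂[innerSL ℝ; μ]
      map_add' := fun φ ψ => by
        rw [← VectorMeasure.integral_fun_add (hint φ) (hint ψ)]
        exact VectorMeasure.integral_congr_ae (Lp.coeFn_add φ ψ)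
      map_smul' := fun c φ => by
        rw [RingHom.id_apply, ← VectorMeasure.integral_fun_smul]
        exact VectorMeasure.integral_congr_ae (Lp.coeFn_smul c φ) }
  have hL : ∀ φ, ‖L φ‖ ≤ (‖(innerSL ℝ : H →L[ℝ] H →L[ℝ] ℝ)‖ *
      (lam univ ^ ((1 : ℝ) / 1 - 1 / 2)).toReal) * ‖φ‖ := by
    intro φ
    refine VectorMeasure.norm_integral_le_integral_norm.trans ?_
    rw [mul_assoc]
    gcongr
    have h1 := eLpNorm_le_eLpNorm_mul_rpow_measure_univ (μ := lam) (p := 1) (q := 2) (by norm_num)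
      (Lp.aestronglyMeasurable φ)
    rw [eLpNorm_one_eq_lintegral_enorm] at h1
    rw [integral_norm_eq_lintegral_enorm (Lp.aestronglyMeasurable φ), Lp.norm_def, mul_comm,
      ← ENNReal.toReal_mul]
    refine ENNReal.toReal_mono ?_ (by simpa using h1)
    have := Lp.eLpNorm_ne_top φ
    refine ENNReal.mul_ne_top this ?_
    exact ENNReal.rpow_ne_top_of_nonneg (by norm_num) (measure_ne_top _ _)
  let L' : StrongDual ℝ (Lp H 2 lam) := L.mkContinuous _ hL
  let w := (InnerProductSpace.toDual ℝ (Lp H 2 lam)).symm L'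
  have hw : Integrable w lam := (Lp.memLp w).integrable (by norm_num)
  refine ⟨w, hw, ?_⟩
  ext s hs : 1
  rw [withDensityᵥ_apply hw hs]
  refine ext_inner_left ℝ fun h => ?_
  -- Testing on `1_s h` recovers `⟨h, μ(s)⟩`.
  have h1 : inner ℝ w (indicatorConstLp 2 hs (measure_ne_top lam s) h) =
      L (indicatorConstLp 2 hs (measure_ne_top lam s) h) := by
    rw [← InnerProductSpace.toDual_apply_apply (𝕜 := ℝ), LinearIsometryEquiv.apply_symm_apply]
    rfl
  rw [real_inner_comm, L2.inner_indicatorConstLp_eq_inner_setIntegral] at h1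
  rw [h1]
  change _ = ∫ᵛ x, _ ∂[innerSL ℝ; μ]
  rw [VectorMeasure.integral_congr_ae indicatorConstLp_coeFn,
    VectorMeasure.integral_indicator hs]
  have : IsFiniteMeasure (μ.restrict s).variation := by
    rw [VectorMeasure.variation_restrict hs]; infer_instance
  rw [VectorMeasure.integral_const]
  rw [VectorMeasure.restrict_apply _ hs MeasurableSet.univ, univ_inter]
  rfl

/-- The Radon-Nikodym theorem for vector measures of finite variation in a Hilbert space. -/
theorem MeasureTheory.VectorMeasure.exists_eq_withDensityᵥ (μ : VectorMeasure X H)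
    [IsFiniteMeasure μ.variation] (ν : Measure X) [IsFiniteMeasure ν] (hac : μ.variation ≪ ν) :
    ∃ v : X → H, Integrable v ν ∧ μ = ν.withDensityᵥ v := by
  obtain ⟨w, hw, hμ⟩ := μ.exists_eq_withDensityᵥ_variation
  have hd : ν.withDensity (μ.variation.rnDeriv ν) = μ.variation :=
    Measure.withDensity_rnDeriv_eq _ _ hac
  have hi : Integrable (fun x => (μ.variation.rnDeriv ν x).toReal • w x) ν :=
    (integrable_rnDeriv_smul_iff hac).2 hw
  refine ⟨_, hi, ?_⟩
  rw [withDensityᵥ_smul_eq_withDensityᵥ_withDensity'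
    (Measure.measurable_rnDeriv _ _).aemeasurable (Measure.rnDeriv_lt_top _ _) hi, hd]
  exact hμ

end RadonNikodym

/-- Every measurable part of a `ν`-null set is again `ν`-null, so `μ` restricted to such a set
vanishes identically and has no variation. -/
theorem MeasureTheory.VectorMeasure.variation_absolutelyContinuous {X E : Type*}
    [MeasurableSpace X] [NormedAddCommGroup E] {μ : VectorMeasure X E}
    {ν : Measure X} (h : μ ≪ᵥ ν.toENNRealVectorMeasure) : μ.variation ≪ ν := by
  refine Measure.AbsolutelyContinuous.mk fun s hs h0 => ?_
  have h1 : (μ.restrict s).variation ≤ 0 := by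
    refine VectorMeasure.variation_le_of_forall_enorm_le fun t ht => ?_
    rw [VectorMeasure.restrict_apply _ hs ht, h, enorm_zero]
    · exact zero_le
    · rw [Measure.toENNRealVectorMeasure_apply_measurable (ht.inter hs)]
      exact measure_mono_null inter_subset_right h0
  rw [VectorMeasure.variation_restrict hs] at h1
  simpa using h1 univ

namespace Sweeping

/-! ### Trajectories as primitives of their densities. -/

section Trajectories

variable {T : ℝ}

theorem isBot_initialTime (hT : 0 < T) : IsBot (initialTime hT) := fun t => t.2.1

theorem isTop_finalTime (hT : 0 < T) : IsTop (⟨T, right_mem_Icc.2 hT.le⟩ : TimeInterval T) :=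
  fun t => t.2.2

theorem isFiniteMeasure_variation_differentialMeasure {E : Type*}
    [NormedAddCommGroup E] [CompleteSpace E] (hT : 0 < T) {x : TimeInterval T → E}
    (hx : BoundedVariationOn x univ) : IsFiniteMeasure (differentialMeasure x).variation := by
  rw [differentialMeasure, dif_pos hx]
  exact hx.isFiniteMeasure_variation_vectorMeasure (isBot_initialTime hT) (isTop_finalTime hT)

/-- A continuous approximation of the indicator of `{s | s ≤ t}`, equal to it on this set. -/
noncomputable def ramp (k : ℕ) (t s : TimeInterval T) : ℝ := max 0 (min 1 (1 - k * ((s : ℝ) - t)))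

theorem ramp_mem (k : ℕ) (t s : TimeInterval T) : 0 ≤ ramp k t s ∧ ramp k t s ≤ 1 :=
  ⟨le_max_left _ _, max_le zero_le_one (min_le_left _ _)⟩

theorem norm_ramp_smul_le {E : Type*} [NormedAddCommGroup E] [NormedSpace ℝ E] (k : ℕ)
    (t s : TimeInterval T) (h : E) : ‖ramp k t s • h‖ ≤ ‖h‖ := by
  rw [norm_smul, Real.norm_of_nonneg (ramp_mem k t s).1]
  exact mul_le_of_le_one_left (norm_nonneg _) (ramp_mem k t s).2

theorem tendsto_ramp (t s : TimeInterval T) :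
    Tendsto (fun k => ramp k t s) atTop (𝓝 ((Iic t).indicator 1 s)) := by
  by_cases hs : s ≤ t
  · have : ∀ k, ramp k t s = 1 := fun k => by
      have h1 : (0 : ℝ) ≤ k * ((t : ℝ) - s) :=
        mul_nonneg k.cast_nonneg (sub_nonneg.2 (Subtype.coe_le_coe.2 hs))
      have h2 : (1 : ℝ) ≤ 1 - k * ((s : ℝ) - t) := by linarith
      rw [ramp, min_eq_left h2, max_eq_right zero_le_one]
    simp [this, hs]
  · have hs' : (0 : ℝ) < (s : ℝ) - t := sub_pos.2 (Subtype.coe_lt_coe.2 (not_le.1 hs))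
    rw [indicator_of_notMem (by simpa using hs)]
    refine tendsto_const_nhds.congr' ?_
    obtain ⟨K, hK⟩ := exists_nat_gt (1 / ((s : ℝ) - t))
    filter_upwards [eventually_ge_atTop K] with k hk
    have hk' : (K : ℝ) ≤ k := by exact_mod_cast hk
    have h1 : 1 < (k : ℝ) * ((s : ℝ) - t) := by
      rw [div_lt_iff₀ hs'] at hK
      nlinarith
    rw [ramp, max_eq_left]
    exact (min_le_right _ _).trans (by linarith)

theorem continuous_ramp (k : ℕ) :
    Continuous fun p : TimeInterval T × TimeInterval T => ramp k p.1 p.2 := by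
  unfold ramp
  fun_prop

/-- The distribution function of an integrable density is the pointwise limit of a uniformly
bounded sequence of continuous functions. -/
theorem exists_continuous_tendsto_setIntegral_Iic {E : Type*} [NormedAddCommGroup E]
    [NormedSpace ℝ E] {ν : Measure (TimeInterval T)} {v : TimeInterval T → E}
    (hv : Integrable v ν) (x₀ : E) :
    ∃ g : ℕ → TimeInterval T → E, (∀ k, Continuous (g k)) ∧
      (∀ k t, ‖g k t‖ ≤ ‖x₀‖ + ∫ s, ‖v s‖ ∂ν) ∧
      ∀ t, Tendsto (fun k => g k t) atTop (𝓝 (x₀ + ∫ s in Iic t, v s ∂ν)) := by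
  have hm : ∀ k (t : TimeInterval T), AEStronglyMeasurable (fun s => ramp k t s • v s) ν :=
    fun k t => ((continuous_ramp k).comp (Continuous.prodMk_right t)).aestronglyMeasurable.smul
      hv.1
  -- Smearing the cutoff makes the primitive continuous even if `ν` has atoms. Since the ramp is `1`
  -- up to and including `t`, the limit keeps an atom at `t`.
  refine ⟨fun k t => x₀ + ∫ s, ramp k t s • v s ∂ν, fun k => ?_, fun k t => ?_, fun t => ?_⟩
  · refine continuous_const.add (continuous_of_dominated (hm k)
      (fun t => ae_of_all _ fun s => norm_ramp_smul_le k t s (v s)) hv.norm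
      (ae_of_all _ fun s => ?_))
    exact ((continuous_ramp k).comp (Continuous.prodMk_left s)).smul continuous_const
  · refine (norm_add_le _ _).trans ?_
    gcongr
    exact norm_integral_le_of_norm_le hv.norm
      (ae_of_all _ fun s => norm_ramp_smul_le k t s (v s))
  · refine tendsto_const_nhds.add ?_
    rw [← integral_indicator measurableSet_Iic]
    refine tendsto_integral_of_dominated_convergence _ (hm · t) hv.norm
      (fun k => ae_of_all _ fun s => norm_ramp_smul_le k t s (v s)) (ae_of_all _ fun s => ?_)
    have := (tendsto_ramp t s).smul_const (v s)
    convert this using 2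
    by_cases hs : s ∈ Iic t <;> simp [hs]

variable {H : Type*} [NormedAddCommGroup H] [InnerProductSpace ℝ H] [CompleteSpace H]
  {ν : Measure (TimeInterval T)} {x v : TimeInterval T → H}

theorem exists_isDensity [IsFiniteMeasure ν] (hT : 0 < T) (hx : BoundedVariationOn x univ)
    (hac : (differentialMeasure x).variation ≪ ν) : ∃ v, IsDensity x ν v := by
  have := isFiniteMeasure_variation_differentialMeasure hT hx
  exact (differentialMeasure x).exists_eq_withDensityᵥ ν hac

theorem isDensity_density (h : ∃ v, IsDensity x ν v) : IsDensity x ν (density x ν) := by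
  rw [density, dif_pos h]
  exact h.choose_spec

/-- A right-continuous function of bounded variation is recovered from its density. -/
theorem IsDensity.eq_add_setIntegral (hT : 0 < T) (hr : ∀ t, ContinuousWithinAt x (Ici t) t)
    (hx : BoundedVariationOn x univ) (hv : IsDensity x ν v) (t : TimeInterval T) :
    x t = x (initialTime hT) + ∫ s in Iic t, v s ∂ν := by
  have hI : Iic t = Icc (initialTime hT) t := by
    ext s
    simp [isBot_initialTime hT s]
  -- Including time `0` is harmless: the left limit at a bottom point is the value itself, so
  -- right-continuity leaves no atom there.
  rw [← withDensityᵥ_apply hv.1 measurableSet_Iic, ← hv.2, differentialMeasure, dif_pos hx, hI,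
    hx.vectorMeasure_Icc (isBot_initialTime hT t), (hr t).rightLim_eq,
    leftLim_eq_of_isBot (isBot_initialTime hT)]
  abel

/-- Integration against the variation of `dx` when `dx = v dν`. -/
theorem IsDensity.integral_variation (hv : IsDensity x ν v) (g : TimeInterval T → ℝ) :
    ∫ t, g t ∂(differentialMeasure x).variation = ∫ t, ‖v t‖ * g t ∂ν := by
  rw [hv.2, Measure.variation_withDensityᵥ hv.1,
    integral_withDensity_eq_integral_toReal_smul₀ hv.1.1.enorm (by simp)]
  simp

end Trajectories

/-! ### Equi-integrability. -/

section UniformIntegrability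

variable {X ι E : Type*} [MeasurableSpace X] [NormedAddCommGroup E] {ν : Measure X}

/-- The integrals of `‖v i‖` over sets of small measure are uniformly small. -/
def HasEquiSmallIntegrals (ν : Measure X) (v : ι → X → E) : Prop :=
  ∀ ε : ℝ, 0 < ε → ∃ δ : ℝ≥0∞, 0 < δ ∧ ∀ (i : ι) (A : Set X), ν A < δ →
    ∫ t in A, ‖v i t‖ ∂ν ≤ ε

theorem hasEquiSmallIntegrals_of_forall_setLIntegral {v : ι → X → E}
    (hv : ∀ i, AEStronglyMeasurable (v i) ν)
    (h : ∀ ε : ℝ≥0∞, 0 < ε → ∃ δ : ℝ≥0∞, 0 < δ ∧ ∀ (i : ι) (A : Set X), ν A < δ →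
      ∫⁻ t in A, ‖v i t‖ₑ ∂ν < ε) : HasEquiSmallIntegrals ν v := by
  intro ε hε
  obtain ⟨δ, hδ, hA⟩ := h (ENNReal.ofReal ε) (ENNReal.ofReal_pos.2 hε)
  refine ⟨δ, hδ, fun i A hiA => ?_⟩
  rw [integral_norm_eq_lintegral_enorm (hv i).restrict]
  exact ENNReal.toReal_le_of_le_ofReal hε.le (hA i A hiA).le

/-- Absolute continuity of the integral. The index type `Unit` lets a single density use the
estimates for families. -/
theorem hasEquiSmallIntegrals_const {v : X → E} (hv : Integrable v ν) :
    HasEquiSmallIntegrals ν (fun _ : Unit => v) := by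
  refine hasEquiSmallIntegrals_of_forall_setLIntegral (fun _ => hv.1) fun ε hε => ?_
  obtain ⟨δ, hδ, h⟩ := exists_pos_setLIntegral_lt_of_measure_lt hv.2.ne hε.ne'
  exact ⟨δ, hδ, fun _ => h⟩

/-- Boundedness in `L^p` with `p > 1` implies equi-integrability. -/
theorem hasEquiSmallIntegrals_of_eLpNorm_le {v : ι → X → E} {p : ℝ≥0∞} (hp : 1 < p) {M : ℝ≥0}
    (hv : ∀ i, AEStronglyMeasurable (v i) ν) (hM : ∀ i, eLpNorm (v i) p ν ≤ M) :
    HasEquiSmallIntegrals ν v := by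
  refine hasEquiSmallIntegrals_of_forall_setLIntegral hv fun ε hε => ?_
  -- Hölder exponent for `L^p` against `L¹`. For `p = ∞`, `toReal` is `0` and `1 / 0 = 0`, so `r =
  -- 1` as it should be.
  set r : ℝ := 1 / (1 : ℝ≥0∞).toReal - 1 / p.toReal with hr
  have hr0 : 0 < r := by
    rcases eq_or_ne p ∞ with rfl | hp'
    · simp [hr]
    · have : 1 < p.toReal := by
        simpa using (ENNReal.toReal_lt_toReal ENNReal.one_ne_top hp').2 hp
      rw [hr, ENNReal.toReal_one, div_one, sub_pos, div_lt_one (by linarith)]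
      exact this
  have ht : Tendsto (fun a : ℝ≥0∞ => (M : ℝ≥0∞) * a ^ r) (𝓝 0) (𝓝 0) := by
    have h1 : Tendsto (fun a : ℝ≥0∞ => a ^ r) (𝓝 0) (𝓝 0) := by
      simpa [ENNReal.zero_rpow_of_pos hr0] using
        (ENNReal.continuous_rpow_const (y := r)).tendsto (0 : ℝ≥0∞)
    simpa using ENNReal.Tendsto.const_mul h1 (Or.inr ENNReal.coe_ne_top)
  obtain ⟨δ, hδ, h⟩ := ENNReal.nhds_zero_basis.eventually_iff.1 (ht.eventually_lt_const hε)
  refine ⟨δ, hδ, fun i A hA => lt_of_le_of_lt ?_ (h hA)⟩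
  rw [← eLpNorm_one_eq_lintegral_enorm]
  refine (eLpNorm_le_eLpNorm_mul_rpow_measure_univ hp.le (hv i).restrict).trans ?_
  rw [Measure.restrict_apply_univ]
  gcongr
  exact (eLpNorm_restrict_le _ _ _ _).trans (hM i)

/-- Bounded pointwise convergence is uniform along an equi-integrable bounded family. -/
theorem HasEquiSmallIntegrals.eventually_integral_mul_le [IsFiniteMeasure ν] {F : Type*}
    [NormedAddCommGroup F] {v : ι → X → E} (h : HasEquiSmallIntegrals ν v)
    (hv : ∀ i, Integrable (v i) ν) {B : ℝ} (hB : ∀ i, ∫ t, ‖v i t‖ ∂ν ≤ B)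
    {g : ℕ → X → F} {f : X → F} (hg : ∀ k, StronglyMeasurable (g k)) (hf : StronglyMeasurable f)
    (hgf : ∀ t, Tendsto (fun k => g k t) atTop (𝓝 (f t))) {D : ℝ} (hgD : ∀ k t, ‖g k t‖ ≤ D)
    (hfD : ∀ t, ‖f t‖ ≤ D) {ε : ℝ} (hε : 0 < ε) :
    ∀ᶠ k in atTop, ∀ i, ∫ t, ‖v i t‖ * ‖g k t - f t‖ ∂ν ≤ ε := by
  set B' := max B 0 + 1
  have hB' : 0 < B' := by positivity
  set D' := max D 0 + 1
  have hD' : 0 < D' := by positivity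
  -- The error splits at the level `ε / (2 * B')` of `‖g k - f‖`: below it the `L¹` bound costs `ε /
  -- 2`; above it the difference is at most `2 * D'` on a set of measure below `δ`, costing another
  -- `ε / 2`.
  obtain ⟨δ, hδ, hA⟩ := h (ε / (2 * (2 * D'))) (by positivity)
  have hm := tendstoInMeasure_iff_norm.1 (tendstoInMeasure_of_tendsto_ae
    (μ := ν) (fun k => (hg k).aestronglyMeasurable) (ae_of_all _ hgf)) (ε / (2 * B'))
      (by positivity)
  filter_upwards [hm.eventually_lt_const hδ] with k hk i
  set A := {t | ε / (2 * B') ≤ ‖g k t - f t‖} with hAdef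
  have hAm : MeasurableSet A :=
    measurableSet_le measurable_const ((hg k).sub hf).norm.measurable
  have hi1 : Integrable (fun t => ε / (2 * B') * ‖v i t‖) ν := (hv i).norm.const_mul _
  have hi2 : Integrable (A.indicator fun t => 2 * D' * ‖v i t‖) ν :=
    ((hv i).norm.const_mul _).indicator hAm
  have hDD : D ≤ D' := (le_max_left D 0).trans (le_add_of_nonneg_right zero_le_one)
  calc ∫ t, ‖v i t‖ * ‖g k t - f t‖ ∂ν
      ≤ ∫ t, (ε / (2 * B') * ‖v i t‖ + A.indicator (fun t => 2 * D' * ‖v i t‖) t) ∂ν := by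
        refine integral_mono_of_nonneg (ae_of_all _ fun t => by positivity) (hi1.add hi2)
          (ae_of_all _ fun t => ?_)
        by_cases ht : t ∈ A
        · simp only [ht, indicator_of_mem]
          have h1 : ‖g k t - f t‖ ≤ 2 * D' :=
            (norm_sub_le _ _).trans (by linarith [hgD k t, hfD t])
          have h2 : 0 ≤ ε / (2 * B') * ‖v i t‖ := by positivity
          nlinarith [norm_nonneg (v i t)]
        · simp only [ht, not_false_eq_true, indicator_of_notMem, add_zero]
          rw [hAdef, mem_ofPred_eq, not_le] at ht
          nlinarith [norm_nonneg (v i t)]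
    _ = ε / (2 * B') * ∫ t, ‖v i t‖ ∂ν + 2 * D' * ∫ t in A, ‖v i t‖ ∂ν := by
        rw [integral_add hi1 hi2, integral_indicator hAm, integral_const_mul, integral_const_mul]
    _ ≤ ε / (2 * B') * B' + 2 * D' * (ε / (2 * (2 * D'))) := by
        have h3 : ∫ t, ‖v i t‖ ∂ν ≤ B' := 
          (hB i).trans ((le_max_left B 0).trans (le_add_of_nonneg_right zero_le_one))
        have h4 := hA i A hk
        gcongr
    _ = ε := by field_simp; ring

end UniformIntegrability

end Sweeping

namespace Sweeping

/-! ### Weak convergence of densities from convergence of primitives. -/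

section DensityConvergence

variable {H : Type*} [NormedAddCommGroup H] [InnerProductSpace ℝ H] [CompleteSpace H] {T : ℝ}
  {ν : Measure (TimeInterval T)}

theorem tendsto_of_forall_approx {a : ℕ → ℝ} {a' : ℝ}
    (h : ∀ ε : ℝ, 0 < ε → ∃ (b : ℕ → ℝ) (b' : ℝ), Tendsto b atTop (𝓝 b') ∧
      (∀ᶠ n in atTop, |a n - b n| ≤ ε) ∧ |a' - b'| ≤ ε) : Tendsto a atTop (𝓝 a') := by
  rw [Metric.tendsto_nhds]
  intro ε hε
  obtain ⟨b, b', hb, hab, hab'⟩ := h (ε / 4) (by positivity)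
  filter_upwards [hab, Metric.tendsto_nhds.1 hb (ε / 4) (by positivity)] with n h1 h2
  rw [Real.dist_eq, abs_lt] at *
  rw [abs_le] at h1 hab'
  constructor <;> linarith

/-- If the primitives of a bounded sequence in `L¹` tend to zero pointwise, then its pairings with
continuous functions tend to zero. -/
theorem tendsto_integral_inner_zero (hT : 0 < T) {w : ℕ → TimeInterval T → H}
    (hw : ∀ n, Integrable (w n) ν) {B : ℝ} (hB : ∀ n, ∫ t, ‖w n t‖ ∂ν ≤ B)
    (hconv : ∀ t, Tendsto (fun n => ∫ s in Iic t, w n s ∂ν) atTop (𝓝 0))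
    {φ : TimeInterval T → H} (hφ : Continuous φ) :
    Tendsto (fun n => ∫ t, inner ℝ (w n t) (φ t) ∂ν) atTop (𝓝 0) := by
  obtain ⟨D, hD⟩ := (isCompact_range hφ).isBounded.exists_norm_le
  replace hD : ∀ t, ‖φ t‖ ≤ D := fun t => hD _ (mem_range_self t)
  have hi : ∀ n, Integrable (fun t => inner ℝ (w n t) (φ t)) ν := fun n =>
    ((hw n).norm.mul_const D).mono' ((hw n).1.inner hφ.aestronglyMeasurable)
      (ae_of_all _ fun t => (norm_inner_le_norm _ _).trans
        (mul_le_mul_of_nonneg_left (hD t) (norm_nonneg _)))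
  have hconst : ∀ n (A : Set (TimeInterval T)) (h : H),
      ∫ s in A, inner ℝ (w n s) h ∂ν = inner ℝ (∫ s in A, w n s ∂ν) h := fun n A h => by
    rw [real_inner_comm, ← integral_inner (hw n).integrableOn]
    simp_rw [real_inner_comm h]
  refine tendsto_of_forall_approx fun η hη => ?_
  have hB0 : 0 ≤ B := (integral_nonneg fun t => norm_nonneg _).trans (hB 0)
  -- An oscillation `ε` of `φ` on each cell costs at most `ε * B ≤ η / 2`; the other half absorbs
  -- the null sequence.
  set ε := η / (2 * (B + 1)) with hε
  have hε0 : 0 < ε := by positivity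
  obtain ⟨t, ht0, htm, ⟨m, hm⟩, hcov⟩ := exists_monotone_Icc_subset_open_cover_Icc hT.le
    (c := fun z : TimeInterval T => φ ⁻¹' Metric.ball (φ z) (ε / 2))
    (fun z => Metric.isOpen_ball.preimage hφ)
    (fun z _ => mem_iUnion.2 ⟨z, Metric.mem_ball_self (by positivity)⟩)
  -- Freezing `φ` at the right end of each cell `]t i, t (i+1)]` leaves an increment of the
  -- primitives, which tends to zero. The base case is the single point `0`, which `ν` may charge.
  have hstep : ∀ i, ∃ c : ℕ → ℝ, Tendsto c atTop (𝓝 0) ∧ ∀ n,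
      |∫ s in Iic (t i), inner ℝ (w n s) (φ s) ∂ν| ≤
        ε * ∫ s in Iic (t i), ‖w n s‖ ∂ν + c n := by
    intro i
    induction i with
    | zero =>
      refine ⟨fun n => |inner ℝ (∫ s in Iic (t 0), w n s ∂ν) (φ (t 0))|, ?_, fun n => ?_⟩
      · simpa using ((hconv (t 0)).inner (𝕜 := ℝ) (tendsto_const_nhds (x := φ (t 0)))).abs
      · have hE : ∫ s in Iic (t 0), inner ℝ (w n s) (φ s) ∂ν =
            ∫ s in Iic (t 0), inner ℝ (w n s) (φ (t 0)) ∂ν := by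
          refine setIntegral_congr_fun measurableSet_Iic fun s hs => ?_
          have : s = t 0 := le_antisymm hs (Subtype.coe_le_coe.1 (ht0.le.trans s.2.1))
          simp [this]
        rw [hE, hconst]
        have : 0 ≤ ∫ s in Iic (t 0), ‖w n s‖ ∂ν := integral_nonneg fun s => norm_nonneg _
        exact le_add_of_nonneg_left (by positivity)
    | succ i ih =>
      obtain ⟨c, hc, hcn⟩ := ih
      set e := φ (t (i + 1))
      refine ⟨fun n => c n + |inner ℝ (∫ s in Ioc (t i) (t (i + 1)), w n s ∂ν) e|,
        ?_, fun n => ?_⟩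
      · have h1 : ∀ n, ∫ s in Ioc (t i) (t (i + 1)), w n s ∂ν =
            ∫ s in Iic (t (i + 1)), w n s ∂ν - ∫ s in Iic (t i), w n s ∂ν := fun n => by
          rw [← Iic_sdiff_Iic, setIntegral_sdiff measurableSet_Iic (hw n).integrableOn
            (Iic_subset_Iic.2 (htm i.le_succ))]
        simp_rw [h1]
        simpa using hc.add ((((hconv _).sub (hconv _)).inner (𝕜 := ℝ)
          (tendsto_const_nhds (x := e))).abs)
      · have hU : Iic (t (i + 1)) = Iic (t i) ∪ Ioc (t i) (t (i + 1)) :=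
          (Iic_union_Ioc_eq_Iic (htm i.le_succ)).symm
        have hd : Disjoint (Iic (t i)) (Ioc (t i) (t (i + 1))) := Iic_disjoint_Ioc le_rfl
        rw [hU, setIntegral_union hd measurableSet_Ioc (hi n).integrableOn (hi n).integrableOn,
          setIntegral_union hd measurableSet_Ioc (hw n).norm.integrableOn
            (hw n).norm.integrableOn]
        have h2 : |∫ s in Ioc (t i) (t (i + 1)), inner ℝ (w n s) (φ s) ∂ν| ≤
            ε * ∫ s in Ioc (t i) (t (i + 1)), ‖w n s‖ ∂ν +
              |inner ℝ (∫ s in Ioc (t i) (t (i + 1)), w n s ∂ν) e| := by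
          have h3 : Integrable (fun s => inner ℝ (w n s) e) ν := (hw n).inner_const e
          have h4 : ∫ s in Ioc (t i) (t (i + 1)), inner ℝ (w n s) (φ s) ∂ν =
              ∫ s in Ioc (t i) (t (i + 1)), inner ℝ (w n s) (φ s - e) ∂ν +
                inner ℝ (∫ s in Ioc (t i) (t (i + 1)), w n s ∂ν) e := by
            simp_rw [inner_sub_right]
            rw [integral_sub (hi n).integrableOn h3.integrableOn, hconst]
            ring
          rw [h4]
          refine (abs_add_le _ _).trans (add_le_add_left ?_ _)
          rw [← integral_const_mul, ← Real.norm_eq_abs]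
          refine norm_integral_le_of_norm_le ((hw n).norm.const_mul ε).integrableOn
            ((ae_restrict_iff' measurableSet_Ioc).2 (ae_of_all _ fun s hs => ?_))
          obtain ⟨z, hz⟩ := hcov i
          have h5 : dist (φ s) (φ z) < ε / 2 := hz (Ioc_subset_Icc_self hs)
          have h6 : dist e (φ z) < ε / 2 := hz (right_mem_Icc.2 (htm i.le_succ))
          have h7 : ‖φ s - e‖ ≤ ε := by
            rw [← dist_eq_norm]
            linarith [dist_triangle_right (φ s) e (φ z)]
          calc ‖inner ℝ (w n s) (φ s - e)‖ ≤ ‖w n s‖ * ‖φ s - e‖ := norm_inner_le_norm _ _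
            _ ≤ ‖w n s‖ * ε := by gcongr
            _ = _ := mul_comm _ _
        refine (abs_add_le _ _).trans ?_
        linarith [hcn n]
  obtain ⟨c, hc, hcn⟩ := hstep m
  have hU : Iic (t m) = univ :=
    eq_univ_of_forall fun s => Subtype.coe_le_coe.1 (s.2.2.trans (hm m le_rfl).ge)
  rw [hU] at hcn
  simp only [Measure.restrict_univ] at hcn
  refine ⟨fun _ => 0, 0, tendsto_const_nhds, ?_, by simpa using hη.le⟩
  filter_upwards [hc.eventually_lt_const (half_pos hη)] with n hn
  rw [sub_zero]
  have h8 : ε * ∫ s, ‖w n s‖ ∂ν ≤ η / 2 := by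
    calc ε * ∫ s, ‖w n s‖ ∂ν ≤ ε * (B + 1) := by
          gcongr
          exact (hB n).trans (by linarith)
      _ = η / 2 := by rw [hε]; field_simp
  linarith [hcn n]

theorem tendsto_integral_inner (hT : 0 < T) {vn : ℕ → TimeInterval T → H}
    {v : TimeInterval T → H} (hvn : ∀ n, Integrable (vn n) ν) (hv : Integrable v ν) {B : ℝ}
    (hB : ∀ n, ∫ t, ‖vn n t‖ ∂ν ≤ B)
    (hconv : ∀ t, Tendsto (fun n => ∫ s in Iic t, vn n s ∂ν) atTop (𝓝 (∫ s in Iic t, v s ∂ν)))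
    {φ : TimeInterval T → H} (hφ : Continuous φ) :
    Tendsto (fun n => ∫ t, inner ℝ (vn n t) (φ t) ∂ν) atTop (𝓝 (∫ t, inner ℝ (v t) (φ t) ∂ν)) := by
  obtain ⟨D, hD⟩ := (isCompact_range hφ).isBounded.exists_norm_le
  have hi : ∀ u : TimeInterval T → H, Integrable u ν →
      Integrable (fun t => inner ℝ (u t) (φ t)) ν := fun u hu =>
    (hu.norm.mul_const D).mono' (hu.1.inner hφ.aestronglyMeasurable)
      (ae_of_all _ fun t => (norm_inner_le_norm _ _).trans
        (mul_le_mul_of_nonneg_left (hD _ (mem_range_self t)) (norm_nonneg _)))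
  have h0 := tendsto_integral_inner_zero (ν := ν) hT (w := fun n t => vn n t - v t)
    (fun n => (hvn n).sub hv) (B := B + ∫ t, ‖v t‖ ∂ν) (fun n => ?_) (fun t => ?_) hφ
  · have h1 := h0.add_const (∫ t, inner ℝ (v t) (φ t) ∂ν)
    simp_rw [inner_sub_left] at h1
    rw [zero_add] at h1
    refine h1.congr fun n => ?_
    rw [integral_sub (hi _ (hvn n)) (hi _ hv), sub_add_cancel]
  · calc ∫ t, ‖vn n t - v t‖ ∂ν ≤ ∫ t, (‖vn n t‖ + ‖v t‖) ∂ν :=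
          integral_mono ((hvn n).sub hv).norm ((hvn n).norm.add hv.norm)
            fun t => norm_sub_le _ _
      _ ≤ B + ∫ t, ‖v t‖ ∂ν := by
          rw [integral_add (hvn n).norm hv.norm]
          gcongr
          exact hB n
  · have h2 := (hconv t).sub_const (∫ s in Iic t, v s ∂ν)
    rw [sub_self] at h2
    refine h2.congr fun n => ?_
    rw [integral_sub (hvn n).integrableOn hv.integrableOn]

end DensityConvergence

/-! ### Continuity of the variational functional. -/

section Functional

variable {H : Type*} [NormedAddCommGroup H] [InnerProductSpace ℝ H] {T : ℝ}
  {ν : Measure (TimeInterval T)}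

/-- The functional `f ↦ ∫ (⟨v, f⟩ + κ ‖v‖ ‖f‖²) dν`. -/
noncomputable def proxFunctional (κ : ℝ) (ν : Measure (TimeInterval T)) (v f : TimeInterval T → H) : ℝ :=
  ∫ t, (inner ℝ (v t) (f t) + κ * ‖v t‖ * ‖f t‖ ^ 2) ∂ν

/-- Factoring `‖a‖² - ‖b‖²` gives a Lipschitz estimate on the ball of radius `D`, with weight `‖v‖`.
The case `b = 0` serves as an integrable bound. -/
theorem abs_inner_add_sub_le {κ D : ℝ} (hκ : 0 ≤ κ) (v a b : H) (ha : ‖a‖ ≤ D) (hb : ‖b‖ ≤ D) :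
    |(inner ℝ v a + κ * ‖v‖ * ‖a‖ ^ 2) - (inner ℝ v b + κ * ‖v‖ * ‖b‖ ^ 2)| ≤
      (1 + 2 * D * κ) * (‖v‖ * ‖a - b‖) := by
  have h1 : |inner ℝ v (a - b)| ≤ ‖v‖ * ‖a - b‖ := abs_real_inner_le_norm _ _
  have h2 : |‖a‖ ^ 2 - ‖b‖ ^ 2| ≤ 2 * D * ‖a - b‖ := by
    rw [sq_sub_sq, abs_mul, abs_of_nonneg (by positivity)]
    have := (norm_nonneg a).trans ha
    gcongr
    · linarith
    · exact abs_norm_sub_norm_le a b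
  calc |(inner ℝ v a + κ * ‖v‖ * ‖a‖ ^ 2) - (inner ℝ v b + κ * ‖v‖ * ‖b‖ ^ 2)|
      = |inner ℝ v (a - b) + κ * ‖v‖ * (‖a‖ ^ 2 - ‖b‖ ^ 2)| := by rw [inner_sub_right]; ring_nf
    _ ≤ ‖v‖ * ‖a - b‖ + κ * ‖v‖ * (2 * D * ‖a - b‖) := by
        refine (abs_add_le _ _).trans (add_le_add h1 ?_)
        rw [abs_mul, abs_of_nonneg (by positivity : 0 ≤ κ * ‖v‖)]
        gcongr
    _ = _ := by ring

theorem integrable_proxIntegrand {κ D : ℝ} (hκ : 0 ≤ κ) {v f : TimeInterval T → H}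
    (hv : Integrable v ν) (hf : AEStronglyMeasurable f ν) (hD : ∀ t, ‖f t‖ ≤ D) :
    Integrable (fun t => inner ℝ (v t) (f t) + κ * ‖v t‖ * ‖f t‖ ^ 2) ν := by
  refine (hv.norm.const_mul ((1 + 2 * D * κ) * D)).mono'
    ((hv.1.inner hf).add ((hv.1.norm.const_mul κ).mul (hf.norm.pow 2)))
    (ae_of_all _ fun t => ?_)
  have hD0 : 0 ≤ D := (norm_nonneg _).trans (hD t)
  have h := abs_inner_add_sub_le hκ (v t) (f t) 0 (hD t) (by simpa using hD0)
  simp only [inner_zero_right, norm_zero, ne_eq, OfNat.ofNat_ne_zero, not_false_eq_true, zero_pow,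
    mul_zero, add_zero, sub_zero] at h
  rw [Real.norm_eq_abs]
  calc _ ≤ _ := h
    _ ≤ (1 + 2 * D * κ) * (‖v t‖ * D) := by gcongr; exact hD t
    _ = _ := by ring

theorem abs_proxFunctional_sub_le {κ D : ℝ} (hκ : 0 ≤ κ) {v f g : TimeInterval T → H}
    (hv : Integrable v ν) (hf : AEStronglyMeasurable f ν) (hg : AEStronglyMeasurable g ν)
    (hfD : ∀ t, ‖f t‖ ≤ D) (hgD : ∀ t, ‖g t‖ ≤ D) :
    |proxFunctional κ ν v f - proxFunctional κ ν v g| ≤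
      (1 + 2 * D * κ) * ∫ t, ‖v t‖ * ‖f t - g t‖ ∂ν := by
  rw [proxFunctional, proxFunctional, ← integral_sub (integrable_proxIntegrand hκ hv hf hfD)
    (integrable_proxIntegrand hκ hv hg hgD), ← integral_const_mul, ← Real.norm_eq_abs]
  refine norm_integral_le_of_norm_le ?_
    (ae_of_all _ fun t => abs_inner_add_sub_le hκ _ _ _ (hfD t) (hgD t))
  refine Integrable.const_mul ?_ _
  refine (hv.norm.mul_const (2 * D)).mono' (hv.1.norm.mul (hf.sub hg).norm)
    (ae_of_all _ fun t => ?_)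
  rw [Real.norm_of_nonneg (by positivity)]
  gcongr
  exact (norm_sub_le _ _).trans (by linarith [hfD t, hgD t])

variable [CompleteSpace H]

/-- Convergence of the primitives handles the linear term only; it says nothing about norms, so the
quadratic term relies on `hvar`. -/
theorem tendsto_proxFunctional_of_continuous (hT : 0 < T) {κ : ℝ} {vn : ℕ → TimeInterval T → H}
    {v : TimeInterval T → H} (hvn : ∀ n, Integrable (vn n) ν) (hv : Integrable v ν) {B : ℝ}
    (hB : ∀ n, ∫ t, ‖vn n t‖ ∂ν ≤ B)
    (hconv : ∀ t, Tendsto (fun n => ∫ s in Iic t, vn n s ∂ν) atTop (𝓝 (∫ s in Iic t, v s ∂ν)))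
    (hvar : ∀ g : TimeInterval T → ℝ, Continuous g →
      Tendsto (fun n => ∫ t, ‖vn n t‖ * g t ∂ν) atTop (𝓝 (∫ t, ‖v t‖ * g t ∂ν)))
    {φ : TimeInterval T → H} (hφ : Continuous φ) :
    Tendsto (fun n => proxFunctional κ ν (vn n) φ) atTop (𝓝 (proxFunctional κ ν v φ)) := by
  obtain ⟨D, hD⟩ := (isCompact_range hφ).isBounded.exists_norm_le
  replace hD : ∀ t, ‖φ t‖ ≤ D := fun t => hD _ (mem_range_self t)
  have h : ∀ u : TimeInterval T → H, Integrable u ν → proxFunctional κ ν u φ =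
      ∫ t, inner ℝ (u t) (φ t) ∂ν + κ * ∫ t, ‖u t‖ * ‖φ t‖ ^ 2 ∂ν := fun u hu => by
    have h1 : Integrable (fun t => inner ℝ (u t) (φ t)) ν := by
      simpa using integrable_proxIntegrand le_rfl hu hφ.aestronglyMeasurable hD
    have h2 : Integrable (fun t => κ * (‖u t‖ * ‖φ t‖ ^ 2)) ν := by
      refine Integrable.const_mul ?_ _
      -- The quadratic term is the integrand for `κ = 1` minus the linear one.
      have h3 := (integrable_proxIntegrand zero_le_one hu hφ.aestronglyMeasurable hD).sub h1
      simpa [Pi.sub_def] using h3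
    rw [← integral_const_mul, ← integral_add h1 h2]
    simp_rw [proxFunctional, mul_assoc]
  simp_rw [fun n => h _ (hvn n), h _ hv]
  exact (tendsto_integral_inner hT hvn hv hB hconv hφ).add
    ((hvar _ (hφ.norm.pow 2)).const_mul κ)

/-- Convergence of the functionals along uniformly convergent arguments whose limit is a bounded
pointwise limit of continuous functions. -/
theorem tendsto_proxFunctional [IsFiniteMeasure ν] (hT : 0 < T) {κ : ℝ} (hκ : 0 ≤ κ)
    {vn : ℕ → TimeInterval T → H} {v : TimeInterval T → H} (hvn : ∀ n, Integrable (vn n) ν)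
    (hv : Integrable v ν) {B : ℝ} (hB : ∀ n, ∫ t, ‖vn n t‖ ∂ν ≤ B)
    (hequi : HasEquiSmallIntegrals ν vn)
    (hconv : ∀ t, Tendsto (fun n => ∫ s in Iic t, vn n s ∂ν) atTop (𝓝 (∫ s in Iic t, v s ∂ν)))
    (hvar : ∀ g : TimeInterval T → ℝ, Continuous g →
      Tendsto (fun n => ∫ t, ‖vn n t‖ * g t ∂ν) atTop (𝓝 (∫ t, ‖v t‖ * g t ∂ν)))
    {fn g : ℕ → TimeInterval T → H} {f : TimeInterval T → H} {D : ℝ}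
    (hfn : ∀ n, AEStronglyMeasurable (fn n) ν) (hfnf : TendstoUniformly fn f atTop)
    (hg : ∀ k, Continuous (g k)) (hgD : ∀ k t, ‖g k t‖ ≤ D)
    (hgf : ∀ t, Tendsto (fun k => g k t) atTop (𝓝 (f t))) :
    Tendsto (fun n => proxFunctional κ ν (vn n) (fn n)) atTop (𝓝 (proxFunctional κ ν v f)) := by
  have hfm : StronglyMeasurable f :=
    stronglyMeasurable_of_tendsto atTop (fun k => (hg k).stronglyMeasurable)
      (tendsto_pi_nhds.2 hgf)
  have hfD : ∀ t, ‖f t‖ ≤ D := fun t => le_of_tendsto' (hgf t).norm fun k => hgD k t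
  have hD0 : 0 ≤ D := (norm_nonneg _).trans (hfD (initialTime hT))
  have hB0 : 0 ≤ B := (integral_nonneg fun t => norm_nonneg _).trans (hB 0)
  refine tendsto_of_forall_approx fun ε hε => ?_
  -- Lipschitz constant at radius `D + 1`; the extra `1` makes room for `fn n`, uniformly close to
  -- `f`.
  set L := 1 + 2 * (D + 1) * κ with hL
  have hL0 : 0 < L := by positivity
  have e1 := hequi.eventually_integral_mul_le hvn hB (fun k => (hg k).stronglyMeasurable) hfm hgf
    hgD hfD (ε := ε / (2 * L)) (by positivity)
  have e2 := (hasEquiSmallIntegrals_const hv).eventually_integral_mul_le (fun _ => hv)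
    (fun _ => le_rfl) (fun k => (hg k).stronglyMeasurable) hfm hgf hgD hfD
    (ε := ε / (2 * L)) (by positivity)
  -- A single `k` serves every `vn n` and `v`; this uniformity is what equi-integrability provides.
  obtain ⟨k, hk1, hk2⟩ := (e1.and e2).exists
  have hgm := (hg k).aestronglyMeasurable (μ := ν)
  have hfD' : ∀ t, ‖f t‖ ≤ D + 1 := fun t => (hfD t).trans (by linarith)
  have hgD' : ∀ t, ‖g k t‖ ≤ D + 1 := fun t => (hgD k t).trans (by linarith)
  have hhalf : L * (ε / (2 * L)) = ε / 2 := by field_simp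
  refine ⟨_, _, tendsto_proxFunctional_of_continuous (κ := κ) hT hvn hv hB hconv hvar (hg k),
    ?_, ?_⟩
  · set η := min 1 (ε / (2 * (L * (B + 1)))) with hη
    have hη0 : 0 < η := by positivity
    filter_upwards [Metric.tendstoUniformly_iff.1 hfnf η hη0] with n hn
    have hn' : ∀ t, ‖fn n t - f t‖ ≤ η := fun t => by
      rw [← dist_eq_norm, dist_comm]
      exact (hn t).le
    have hfnD : ∀ t, ‖fn n t‖ ≤ D + 1 := fun t => by
      have h1 : η ≤ 1 := min_le_left _ _
      have h2 := norm_le_norm_add_norm_sub' (fn n t) (f t)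
      linarith [hn' t, hfD t]
    have h3 := abs_proxFunctional_sub_le hκ (hvn n) (hfn n) hfm.aestronglyMeasurable hfnD hfD'
    have h4 := abs_proxFunctional_sub_le hκ (hvn n) hgm hfm.aestronglyMeasurable hgD' hfD'
    rw [← hL] at h3 h4
    have h5 : ∫ t, ‖vn n t‖ * ‖fn n t - f t‖ ∂ν ≤ η * (B + 1) := by
      calc ∫ t, ‖vn n t‖ * ‖fn n t - f t‖ ∂ν ≤ ∫ t, ‖vn n t‖ * η ∂ν :=
            integral_mono_of_nonneg (ae_of_all _ fun t => by positivity)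
              ((hvn n).norm.mul_const η)
              (ae_of_all _ fun t => mul_le_mul_of_nonneg_left (hn' t) (norm_nonneg _))
        _ = η * ∫ t, ‖vn n t‖ ∂ν := by rw [integral_mul_const, mul_comm]
        _ ≤ η * (B + 1) := by
            gcongr
            linarith [hB n]
    have h6 : L * (η * (B + 1)) ≤ ε / 2 := by
      have h7 : η ≤ ε / (2 * (L * (B + 1))) := min_le_right _ _
      calc L * (η * (B + 1)) ≤ L * (ε / (2 * (L * (B + 1))) * (B + 1)) := by gcongr
        _ = ε / 2 := by field_simp
    have h8 := mul_le_mul_of_nonneg_left h5 hL0.le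
    have h9 := mul_le_mul_of_nonneg_left (hk1 n) hL0.le
    rw [abs_sub_comm] at h4
    refine (abs_sub_le _ (proxFunctional κ ν (vn n) f) _).trans ?_
    linarith
  · have h4 := abs_proxFunctional_sub_le hκ hv hgm hfm.aestronglyMeasurable hgD' hfD'
    rw [← hL] at h4
    have h9 := mul_le_mul_of_nonneg_left (hk2 ()) hL0.le
    rw [abs_sub_comm]
    linarith

end Functional

end Sweeping

namespace Sweeping

/-! ### Regularity of the limit trajectory. -/

section Limit

variable {H : Type*} [NormedAddCommGroup H] {T : ℝ}
  {ν : Measure (TimeInterval T)}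

theorem eVariationOn_le_of_eq_add_setIntegral [NormedSpace ℝ H] {x v : TimeInterval T → H} {x₀ : H}
    (hv : Integrable v ν) (hx : ∀ t, x t = x₀ + ∫ s in Iic t, v s ∂ν) :
    eVariationOn x univ ≤ ENNReal.ofReal (∫ s, ‖v s‖ ∂ν) := by
  refine iSup_le fun p => ?_
  obtain ⟨N, u, hu, -⟩ := p
  set F : TimeInterval T → ℝ := fun t => ∫ s in Iic t, ‖v s‖ ∂ν
  have hstep : ∀ a b, a ≤ b → ‖x b - x a‖ ≤ F b - F a := fun a b hab => by
    have hs : Iic a ⊆ Iic b := Iic_subset_Iic.2 hab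
    rw [hx, hx, add_sub_add_left_eq_sub, ← setIntegral_sdiff measurableSet_Iic hv.integrableOn hs,
      ← setIntegral_sdiff measurableSet_Iic hv.norm.integrableOn hs]
    exact norm_integral_le_integral_norm _
  calc ∑ i ∈ Finset.range N, edist (x (u (i + 1))) (x (u i))
      ≤ ∑ i ∈ Finset.range N, ENNReal.ofReal (F (u (i + 1)) - F (u i)) := by
        refine Finset.sum_le_sum fun i _ => ?_
        rw [edist_dist, dist_eq_norm]
        exact ENNReal.ofReal_le_ofReal (hstep _ _ (hu i.le_succ))
    _ = ENNReal.ofReal (F (u N) - F (u 0)) := by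
        rw [← ENNReal.ofReal_sum_of_nonneg
          (fun i _ => (norm_nonneg _).trans (hstep _ _ (hu i.le_succ))),
          Finset.sum_range_sub (fun i => F (u i))]
    _ ≤ ENNReal.ofReal (∫ s, ‖v s‖ ∂ν) := by
        refine ENNReal.ofReal_le_ofReal ?_
        have h1 : F (u N) ≤ ∫ s, ‖v s‖ ∂ν :=
          setIntegral_le_integral hv.norm (ae_of_all _ fun s => norm_nonneg _)
        have h2 : 0 ≤ F (u 0) := integral_nonneg fun s => norm_nonneg _
        linarith

/-- A weak limit of measures with equi-integrable densities is absolutely continuous. -/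
theorem absolutelyContinuous_of_tendsto_integral [IsFiniteMeasure ν]
    {vn : ℕ → TimeInterval T → H} (hvn : ∀ n, Integrable (vn n) ν)
    (hequi : HasEquiSmallIntegrals ν vn) (μ : Measure (TimeInterval T)) [IsFiniteMeasure μ]
    (hvar : ∀ g : TimeInterval T → ℝ, Continuous g →
      Tendsto (fun n => ∫ t, ‖vn n t‖ * g t ∂ν) atTop (𝓝 (∫ t, g t ∂μ))) : μ ≪ ν := by
  have hK : ∀ K : Set (TimeInterval T), IsCompact K → ν K = 0 → μ K = 0 := by
    intro K hKc h0
    suffices h : ∀ ε : ℝ, 0 < ε → μ.real K ≤ ε by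
      have := le_antisymm (le_of_forall_pos_le_add fun ε hε => by simpa using h ε hε)
        (measureReal_nonneg (μ := μ) (s := K))
      exact (measureReal_eq_zero_iff).1 this
    intro ε hε
    obtain ⟨δ, hδ, hA⟩ := hequi ε hε
    obtain ⟨U, hKU, hU, hUδ⟩ := K.exists_isOpen_lt_of_lt (μ := ν) δ (by rwa [h0])
    -- Urysohn: `1_K ≤ g ≤ 1_U`, so `μ K` is at most the limit of integrals bounded by those of `‖vn
    -- n‖` over `U`.
    obtain ⟨g, hg0, hg1, hg⟩ := exists_continuous_zero_one_of_isClosed (X := TimeInterval T)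
      hU.isClosed_compl hKc.isClosed (disjoint_compl_left_iff_subset.2 hKU)
    have h1 : μ.real K ≤ ∫ t, g t ∂μ := by
      rw [← integral_indicator_one hKc.measurableSet]
      refine integral_mono_of_nonneg (ae_of_all _ fun t => indicator_nonneg (by simp) t)
        (g.continuous.integrable_of_hasCompactSupport (HasCompactSupport.of_compactSpace _))
        (ae_of_all _ fun t => ?_)
      by_cases ht : t ∈ K
      · simp [ht, hg1 ht]
      · simpa [ht] using (hg t).1
    refine h1.trans (le_of_tendsto' (hvar g g.continuous) fun n => ?_)
    refine le_trans ?_ (hA n U hUδ)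
    rw [← integral_indicator hU.measurableSet]
    refine integral_mono_of_nonneg
      (ae_of_all _ fun t => mul_nonneg (norm_nonneg _) (hg t).1)
      ((hvn n).norm.indicator hU.measurableSet) (ae_of_all _ fun t => ?_)
    by_cases ht : t ∈ U
    · simpa [ht] using mul_le_of_le_one_right (norm_nonneg _) (hg t).2
    · simp [ht, hg0 ht]
  refine Measure.AbsolutelyContinuous.mk fun A hA h0 => ?_
  by_contra hne
  obtain ⟨K, hKA, hKc, hK0⟩ := hA.exists_lt_isCompact (pos_iff_ne_zero.2 hne)
  exact hK0.ne' (hK K hKc (measure_mono_null hKA h0))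

theorem continuousWithinAt_of_tendstoUniformly {xn : ℕ → TimeInterval T → H}
    {x : TimeInterval T → H} (h : TendstoUniformly xn x atTop) {s : Set (TimeInterval T)}
    {t : TimeInterval T} (ht : t ∈ s) (hc : ∀ n, ContinuousWithinAt (xn n) s t) :
    ContinuousWithinAt x s t := by
  refine continuousWithinAt_of_locally_uniform_approx_of_continuousWithinAt ht fun u hu => ?_
  obtain ⟨n, hn⟩ := (h u hu).exists
  exact ⟨univ, univ_mem, xn n, hc n, fun y _ => hn y⟩

end Limit

/-! ### Passage to the limit in the variational inequality. -/

section Stability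

variable {H : Type*} [NormedAddCommGroup H] [InnerProductSpace ℝ H] [CompleteSpace H] {T : ℝ}
  {ν : Measure (TimeInterval T)} [IsFiniteMeasure ν]

/-- Stability of the variational inequality: a uniform limit of admissible trajectories with
vanishing residuals is admissible, has a density, and satisfies the inequality. -/
theorem exists_density_of_tendsto_residual (hT : 0 < T) (ρ : ℝ≥0∞)
    {Cn : ℕ → TimeInterval T → Set H} {C : TimeInterval T → Set H}
    (hSAP : SelectionApproximation Cn C ν) (hOSC : OuterSemicontinuity Cn C)
    {x₀ : H} {xn : ℕ → TimeInterval T → H} {x : TimeInterval T → H}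
    (hadm : ∀ n, IsAdmissible hT (Cn n) x₀ (xn n))
    (hac : ∀ n, VectorMeasure.AbsolutelyContinuous (differentialMeasure (xn n))
      ν.toENNRealVectorMeasure)
    (hunif : TendstoUniformly xn x atTop) {p : ℝ≥0∞} (hp : 1 < p)
    (hbdd : ∃ M : ℝ≥0, ∀ n, eLpNorm (density (xn n) ν) p ν ≤ M)
    (hvar : ∀ g : TimeInterval T → ℝ, Continuous g →
      Tendsto (fun n => ∫ t, g t ∂(differentialMeasure (xn n)).variation) atTop
        (𝓝 (∫ t, g t ∂(differentialMeasure x).variation)))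
    (hres : Tendsto (fun n => residual ρ (Cn n) ν (xn n)) atTop (𝓝 0)) :
    IsAdmissible hT C x₀ x ∧ ∃ v, IsDensity x ν v ∧
      ∀ y ∈ testTrajectories C ν, 0 ≤ proxIntegral ρ ν x v y := by
  set vn : ℕ → TimeInterval T → H := fun n => density (xn n) ν
  have hdn : ∀ n, IsDensity (xn n) ν (vn n) := fun n => isDensity_density
    (exists_isDensity hT (hadm n).boundedVariation
      (VectorMeasure.variation_absolutelyContinuous (hac n)))
  have hvn : ∀ n, Integrable (vn n) ν := fun n => (hdn n).1
  obtain ⟨M, hM⟩ := hbdd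
  have hequi : HasEquiSmallIntegrals ν vn :=
    hasEquiSmallIntegrals_of_eLpNorm_le hp (fun n => (hvn n).1) hM
  obtain ⟨B, hB⟩ : ∃ B : ℝ, ∀ n, ∫ t, ‖vn n t‖ ∂ν ≤ B := by
    have hfin : (M : ℝ≥0∞) * ν univ ^ (1 / (1 : ℝ≥0∞).toReal - 1 / p.toReal) ≠ ∞ := by
      refine ENNReal.mul_ne_top ENNReal.coe_ne_top
        (ENNReal.rpow_ne_top_of_nonneg ?_ (measure_ne_top _ _))
      rcases eq_or_ne p ∞ with rfl | hp'
      · simp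
      · have h1 : 1 < p.toReal := by
          simpa using (ENNReal.toReal_lt_toReal ENNReal.one_ne_top hp').2 hp
        rw [ENNReal.toReal_one, div_one, sub_nonneg, div_le_one (by linarith)]
        exact h1.le
    refine ⟨(M * ν univ ^ (1 / (1 : ℝ≥0∞).toReal - 1 / p.toReal)).toReal, fun n => ?_⟩
    rw [integral_norm_eq_lintegral_enorm (hvn n).1, ← eLpNorm_one_eq_lintegral_enorm]
    refine ENNReal.toReal_mono hfin ?_
    refine (eLpNorm_le_eLpNorm_mul_rpow_measure_univ hp.le (hvn n).1).trans ?_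
    gcongr
    exact hM n
  have hrep : ∀ n t, xn n t = x₀ + ∫ s in Iic t, vn n s ∂ν := fun n t => by
    rw [← (hadm n).initial]
    exact (hdn n).eq_add_setIntegral hT (hadm n).rightContinuous (hadm n).boundedVariation t
  have hbv : BoundedVariationOn x univ := by
    refine ne_top_of_le_ne_top (b := ENNReal.ofReal B) ENNReal.ofReal_ne_top ?_
    -- Lower semicontinuity of the variation under pointwise convergence transfers the uniform bound
    -- `B`.
    refine le_of_forall_lt fun c hc => ?_
    obtain ⟨n, hn⟩ := (eVariationOn.lowerSemicontinuous_aux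
      (fun t _ => hunif.tendsto_at t) hc).exists
    exact hn.trans_le ((eVariationOn_le_of_eq_add_setIntegral (hvn n) (hrep n)).trans
      (ENNReal.ofReal_le_ofReal (hB n)))
  have hx : IsAdmissible hT C x₀ x :=
    { rightContinuous := fun t => continuousWithinAt_of_tendstoUniformly hunif self_mem_Ici
        fun n => (hadm n).rightContinuous t
      boundedVariation := hbv
      initial := tendsto_nhds_unique (hunif.tendsto_at _)
        (tendsto_const_nhds.congr fun n => (hadm n).initial.symm)
      mem := fun t => hOSC t (fun n => xn n t) (x t) (fun n => (hadm n).mem t)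
        (hunif.tendsto_at t) }
  have hvar' : ∀ g : TimeInterval T → ℝ, Continuous g →
      Tendsto (fun n => ∫ t, ‖vn n t‖ * g t ∂ν) atTop
        (𝓝 (∫ t, g t ∂(differentialMeasure x).variation)) := fun g hg => by
    simpa only [fun n => (hdn n).integral_variation g] using hvar g hg
  have := isFiniteMeasure_variation_differentialMeasure hT hbv
  obtain ⟨v, hd⟩ := exists_isDensity hT hbv
    (absolutelyContinuous_of_tendsto_integral hvn hequi _ hvar')
  have hrepx : ∀ t, x t = x₀ + ∫ s in Iic t, v s ∂ν := fun t => by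
    rw [← hx.initial]
    exact hd.eq_add_setIntegral hT hx.rightContinuous hbv t
  refine ⟨hx, v, hd, fun y hy => ?_⟩
  obtain ⟨yn, hyn, hyy⟩ := hSAP y hy
  obtain ⟨g, hgc, hgb, hgx⟩ := exists_continuous_tendsto_setIntegral_Iic hd.1 x₀
  simp_rw [← hrepx] at hgx
  obtain ⟨D, hD⟩ := (isCompact_range hy.1).isBounded.exists_norm_le
  have hxnm : ∀ n, StronglyMeasurable (xn n) := fun n => by
    obtain ⟨gn, hgnc, -, hgnx⟩ := exists_continuous_tendsto_setIntegral_Iic (hvn n) x₀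
    simp_rw [← hrep] at hgnx
    exact stronglyMeasurable_of_tendsto atTop (fun k => (hgnc k).stronglyMeasurable)
      (tendsto_pi_nhds.2 hgnx)
  have hlim : Tendsto (fun n => proxIntegral ρ ν (xn n) (vn n) (yn n)) atTop
      (𝓝 (proxIntegral ρ ν x v y)) := by
    refine tendsto_proxFunctional (κ := halfInv ρ) (fn := fun n t => yn n t - xn n t)
      (g := fun k t => y t - g k t) (f := fun t => y t - x t)
      (D := D + (‖x₀‖ + ∫ s, ‖v s‖ ∂ν)) hT ENNReal.toReal_nonneg hvn hd.1 hB hequi (fun t => ?_)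
      (fun g hg => ?_) (fun n => ?_) (hyy.sub hunif) (fun k => hy.1.sub (hgc k))
      (fun k t => ?_) (fun t => tendsto_const_nhds.sub (hgx t))
    · have h1 := (hunif.tendsto_at t).sub_const x₀
      simpa only [hrep, hrepx, add_sub_cancel_left] using h1
    · rw [← hd.integral_variation]
      exact hvar' g hg
    · exact ((hyn n).1.stronglyMeasurable.sub (hxnm n)).aestronglyMeasurable
    · exact (norm_sub_le _ _).trans (add_le_add (hD _ (mem_range_self t)) (hgb k t))
  -- Each `yn n` competes in the infimum, so the limit of the residuals bounds the limit integral
  -- from below.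
  have hle : ∀ n, residual ρ (Cn n) ν (xn n) ≤
      (proxIntegral ρ ν (xn n) (vn n) (yn n) : EReal) := fun n => iInf₂_le (yn n) (hyn n)
  have h0 : (0 : EReal) ≤ (proxIntegral ρ ν x v y : EReal) :=
    le_of_tendsto_of_tendsto' hres ((continuous_coe_real_ereal.tendsto _).comp hlim) hle
  exact EReal.coe_nonneg.1 h0

end Stability

end Sweeping

namespace Sweeping

/-! ### From the integral inequality to the pointwise inclusion. -/

section Localization

variable {T : ℝ} {ν : Measure (TimeInterval T)} [IsFiniteMeasure ν]

/-- Lusin's theorem for Bochner integrable functions on a compact interval. -/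
theorem exists_isCompact_continuousOn {E : Type*} [NormedAddCommGroup E] [NormedSpace ℝ E]
    {f : TimeInterval T → E} (hf : Integrable f ν) {ε : ℝ≥0∞} (hε : 0 < ε) :
    ∃ K : Set (TimeInterval T), IsCompact K ∧ ν Kᶜ < ε ∧ ContinuousOn f K := by
  -- Density of continuous functions in `L¹`, an a.e. convergent subsequence and Egorov; no
  -- separability of `E` is needed.
  choose g hg hgi using fun k : ℕ => hf.exists_boundedContinuous_lintegral_sub_le
    (ε := ((k : ℝ≥0∞) + 1)⁻¹) (by simp)
  have hm : TendstoInMeasure ν (fun k => (g k : TimeInterval T → E)) atTop f := by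
    refine tendstoInMeasure_of_tendsto_eLpNorm one_ne_zero
      (fun k => (g k).continuous.aestronglyMeasurable) hf.1 ?_
    refine tendsto_of_tendsto_of_tendsto_of_le_of_le tendsto_const_nhds (g := 0)
      (h := fun k : ℕ => ((k : ℝ≥0∞) + 1)⁻¹) ?_ (fun _ => zero_le) (fun k => ?_)
    · have := (tendsto_add_atTop_iff_nat 1).2 ENNReal.tendsto_inv_nat_nhds_zero
      simpa using this
    · rw [eLpNorm_one_eq_lintegral_enorm]
      refine le_trans (le_of_eq (lintegral_congr fun t => ?_)) (hg k)
      rw [Pi.sub_apply, ← enorm_neg, neg_sub]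
  obtain ⟨ns, -, hns⟩ := hm.exists_seq_tendsto_ae
  obtain ⟨f', hf'm, hff'⟩ := hf.1
  have hns' : ∀ᵐ t ∂ν, Tendsto (fun k => g (ns k) t) atTop (𝓝 (f' t)) := by
    filter_upwards [hns, hff'] with t h1 h2
    rwa [← h2]
  obtain ⟨δ, hδ, hδε⟩ := ENNReal.lt_iff_exists_nnreal_btwn.1 (ENNReal.half_pos hε.ne')
  obtain ⟨A, hAm, hA, hunif⟩ := tendstoUniformlyOn_of_ae_tendsto'
    (fun k => (g (ns k)).continuous.stronglyMeasurable) hf'm hns' (ε := δ)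
    (by exact_mod_cast hδ)
  have hc : ContinuousOn f' Aᶜ :=
    hunif.continuousOn (Frequently.of_forall fun k => (g (ns k)).continuous.continuousOn)
  obtain ⟨N, hN, hNm, hN0⟩ := exists_measurable_superset_of_null (ae_iff.1 hff')
  have hcN : ContinuousOn f (A ∪ N)ᶜ := by
    refine (hc.mono (compl_subset_compl.2 subset_union_left)).congr fun t ht => ?_
    by_contra hne
    exact ht (Or.inr (hN hne))
  have hlt : ν (A ∪ N) < ε / 2 := by
    refine (measure_union_le _ _).trans_lt ?_
    rw [hN0, add_zero]
    exact hA.trans_lt (by simpa using hδε)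
  obtain ⟨K, hKA, hKc, hK⟩ := (hAm.union hNm).compl.exists_isCompact_sdiff_lt
    (measure_ne_top ν _) (ENNReal.half_pos hε.ne').ne'
  refine ⟨K, hKc, ?_, hcN.mono hKA⟩
  have hsub : Kᶜ ⊆ (A ∪ N) ∪ ((A ∪ N)ᶜ \ K) := fun t ht => by
    by_cases h : t ∈ A ∪ N
    · exact Or.inl h
    · exact Or.inr ⟨h, ht⟩
  calc ν Kᶜ ≤ ν (A ∪ N) + ν ((A ∪ N)ᶜ \ K) := (measure_mono hsub).trans (measure_union_le _ _)
    _ < ε / 2 + ε / 2 := ENNReal.add_lt_add hlt hK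
    _ = ε := ENNReal.add_halves ε

variable {H : Type*} [NormedAddCommGroup H] [InnerProductSpace ℝ H]

/-- The integral inequality localizes along every continuous selection of the moving set. -/
theorem ae_nonneg_of_continuous_selection {C : TimeInterval T → Set H}
    (hC : HasSelectionExtension C) {κ : ℝ} (hκ : 0 ≤ κ) {x v w : TimeInterval T → H}
    (hxm : StronglyMeasurable x) {D : ℝ} (hxD : ∀ t, ‖x t‖ ≤ D) (hxC : ∀ t, x t ∈ C t)
    (hv : Integrable v ν)
    (hJ : ∀ y ∈ testTrajectories C ν, 0 ≤ proxFunctional κ ν v (fun t => y t - x t))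
    (hw : Continuous w) (hwC : ∀ t, w t ∈ C t) :
    ∀ᵐ t ∂ν, 0 ≤ inner ℝ (v t) (w t - x t) + κ * ‖v t‖ * ‖w t - x t‖ ^ 2 := by
  obtain ⟨D', hD'⟩ := (isCompact_range hw).isBounded.exists_norm_le
  replace hD' : ∀ t, ‖w t‖ ≤ D' := fun t => hD' _ (mem_range_self t)
  rcases isEmpty_or_nonempty (TimeInterval T) with hem | ⟨⟨t₀⟩⟩
  · exact ae_of_all _ fun t => hem.elim t
  have hD0 : 0 ≤ D := (norm_nonneg _).trans (hxD t₀)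
  have hD'0 : 0 ≤ D' := (norm_nonneg _).trans (hD' t₀)
  -- `R` is fixed before any compact set is chosen, so the errors below are uniform. The radius
  -- covers `‖w - x‖ ≤ D' + D`.
  obtain ⟨R, hR, hext⟩ := hC x ((isBounded_iff_forall_norm_le).2
    ⟨D, by rintro _ ⟨t, rfl⟩; exact hxD t⟩) hxC (D' + D + 1) (by positivity)
  set F : (TimeInterval T → H) → TimeInterval T → ℝ := fun y t =>
    inner ℝ (v t) (y t - x t) + κ * ‖v t‖ * ‖y t - x t‖ ^ 2
  have hFi : ∀ (y : TimeInterval T → H) (S : ℝ), Continuous y → (∀ t, ‖y t‖ ≤ S) →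
      Integrable (F y) ν := fun y S hy hS =>
    integrable_proxIntegrand (D := S + D) hκ hv
      (hy.stronglyMeasurable.sub hxm).aestronglyMeasurable
      fun t => (norm_sub_le _ _).trans (add_le_add (hS t) (hxD t))
  set L := max R D' + D
  have hL : 0 ≤ L := by positivity
  set c := (1 + 2 * L * κ) * L
  have hc : 0 ≤ c := by positivity
  have hFb : ∀ (y : TimeInterval T → H), (∀ t, ‖y t‖ ≤ max R D') → ∀ t, |F y t| ≤ c * ‖v t‖ := by
    intro y hy t
    have h1 : ‖y t - x t‖ ≤ L := (norm_sub_le _ _).trans (add_le_add (hy t) (hxD t))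
    have h := abs_inner_add_sub_le hκ (v t) (y t - x t) 0 h1 (by simpa using hL)
    simp only [inner_zero_right, norm_zero, ne_eq, OfNat.ofNat_ne_zero, not_false_eq_true,
      zero_pow, mul_zero, add_zero, sub_zero] at h
    calc |F y t| ≤ (1 + 2 * L * κ) * (‖v t‖ * ‖y t - x t‖) := h
      _ ≤ (1 + 2 * L * κ) * (‖v t‖ * L) := by gcongr
      _ = c * ‖v t‖ := by simp only [c]; ring
  have hwi := hFi w D' hw hD'
  refine ae_nonneg_of_forall_setIntegral_nonneg hwi fun E hE _ => ?_
  refine le_of_forall_pos_le_add fun ε hε => ?_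
  obtain ⟨δ, hδ, hsmall⟩ := hasEquiSmallIntegrals_const hv (ε / (2 * (c + 1))) (by positivity)
  have hδ3 : δ / 3 ≠ 0 := (ENNReal.div_pos hδ.ne' (by norm_num)).ne'
  have hxi : Integrable x ν :=
    (integrable_const D).mono' hxm.aestronglyMeasurable (ae_of_all _ hxD)
  obtain ⟨K, hKc, hK, hxK⟩ := exists_isCompact_continuousOn hxi (pos_iff_ne_zero.2 hδ3)
  obtain ⟨K₂, hK₂E, hK₂c, hK₂⟩ := hE.exists_isCompact_sdiff_lt (measure_ne_top ν _) hδ3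
  obtain ⟨K₁, hK₁E, hK₁c, hK₁⟩ := hE.compl.exists_isCompact_sdiff_lt (measure_ne_top ν _) hδ3
  classical
  set K₁' := K₁ ∩ K
  have hK₁'c : IsCompact K₁' := hK₁c.inter hKc
  have hdisj : ∀ t ∈ K₁', t ∉ K₂ := fun t ht h2 => hK₁E ht.1 (hK₂E h2)
  -- Equal to `w` on `K₂ ⊆ E` and to `x` on `K₁'`, a part of the complement where `x` is continuous.
  -- The two compact sets are disjoint, so `y` is continuous on their union.
  let y : TimeInterval T → H := fun t => if t ∈ K₂ then w t else x t
  have hyc : ContinuousOn y (K₂ ∪ K₁') := by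
    refine ContinuousOn.union_of_isClosed ?_ ?_ hK₂c.isClosed hK₁'c.isClosed
    · exact hw.continuousOn.congr fun t ht => if_pos ht
    · exact (hxK.mono inter_subset_right).congr fun t ht => if_neg (hdisj t ht)
  have hyC : ∀ t, y t ∈ C t := fun t => by
    by_cases h : t ∈ K₂
    · simpa [y, h] using hwC t
    · simpa [y, h] using hxC t
  have hyx : ∀ t, ‖y t - x t‖ ≤ D' + D + 1 := fun t => by
    by_cases h : t ∈ K₂
    · simp only [y, h, if_true]
      linarith [norm_sub_le (w t) (x t), hD' t, hxD t]
    · simp only [y, h, if_false, sub_self, norm_zero]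
      positivity
  obtain ⟨z, hz, hzC, hzy, hzR⟩ := hext (K₂ ∪ K₁') y (hK₂c.union hK₁'c) hyc (fun t _ => hyC t)
    fun t _ => hyx t
  have hzi := hFi z R hz hzR
  have hJz : 0 ≤ ∫ t, F z t ∂ν := hJ z ⟨hz, ae_of_all _ hzC⟩
  set A := (K₂ ∪ K₁')ᶜ
  have hAm : MeasurableSet A := (hK₂c.union hK₁'c).isClosed.measurableSet.compl
  have hA : ν A < δ := by
    have hsub : A ⊆ Kᶜ ∪ (E \ K₂) ∪ (Eᶜ \ K₁) := fun t ht => by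
      simp only [A, K₁', mem_compl_iff, mem_union, mem_inter_iff, Set.mem_sdiff] at ht ⊢
      tauto
    calc ν A ≤ ν Kᶜ + ν (E \ K₂) + ν (Eᶜ \ K₁) :=
          (measure_mono hsub).trans ((measure_union_le _ _).trans
            (add_le_add (measure_union_le _ _) le_rfl))
      _ < δ / 3 + δ / 3 + δ / 3 := ENNReal.add_lt_add (ENNReal.add_lt_add hK hK₂) hK₁
      _ = δ := ENNReal.add_thirds δ
  -- Off `A` the two integrands agree, because `F` vanishes where `z = x`; on `A` each is at most `c
  -- * ‖v t‖` in absolute value.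
  have hpt : ∀ t, F z t - E.indicator (F w) t ≤ A.indicator (fun t => 2 * c * ‖v t‖) t := by
    intro t
    by_cases ht : t ∈ A
    · rw [indicator_of_mem ht]
      have h1 := (abs_le.1 (hFb z (fun t => (hzR t).trans (le_max_left _ _)) t)).2
      have h2 : -(c * ‖v t‖) ≤ E.indicator (F w) t := by
        have h3 := (abs_le.1 (hFb w (fun t => (hD' t).trans (le_max_right _ _)) t)).1
        by_cases hE' : t ∈ E
        · rwa [indicator_of_mem hE']
        · rw [indicator_of_notMem hE', neg_nonpos]
          positivity
      linarith
    · rw [indicator_of_notMem ht]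
      have ht' : t ∈ K₂ ∪ K₁' := not_not.1 ht
      have hzt : z t = y t := hzy ht'
      rcases ht' with h | h
      · simp [F, hzt, y, h, hK₂E h]
      · have hE' : t ∉ E := hK₁E h.1
        simp [F, hzt, y, hdisj t h, hE']
  have hEi : Integrable (E.indicator (F w)) ν := hwi.indicator hE
  have h1 : ∫ t, F z t ∂ν - ∫ t in E, F w t ∂ν ≤ 2 * c * ∫ t in A, ‖v t‖ ∂ν := by
    rw [← integral_indicator hE, ← integral_sub hzi hEi, ← integral_const_mul,
      ← integral_indicator hAm]
    exact integral_mono (hzi.sub hEi) ((hv.norm.const_mul (2 * c)).indicator hAm) hpt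
  have h2 : 2 * c * ∫ t in A, ‖v t‖ ∂ν ≤ ε := by
    calc 2 * c * ∫ t in A, ‖v t‖ ∂ν ≤ 2 * c * (ε / (2 * (c + 1))) := by
          gcongr
          exact hsmall () A hA
      _ = ε * (c / (c + 1)) := by field_simp
      _ ≤ ε * 1 := by
          gcongr
          rw [div_le_one (by positivity)]
          linarith
      _ = ε := mul_one ε
  linarith

/-- For almost every time, the pointwise proximal inequality holds on the whole moving set. -/
theorem ae_forall_mem_nonneg {C : TimeInterval T → Set H}
    (hC : HasSelectionExtension C) {κ : ℝ} (hκ : 0 ≤ κ) {x v : TimeInterval T → H}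
    (hxm : StronglyMeasurable x) {D : ℝ} (hxD : ∀ t, ‖x t‖ ≤ D) (hxC : ∀ t, x t ∈ C t)
    (hv : Integrable v ν)
    (hJ : ∀ y ∈ testTrajectories C ν, 0 ≤ proxFunctional κ ν v (fun t => y t - x t)) :
    ∀ᵐ t ∂ν, ∀ z ∈ C t, 0 ≤ inner ℝ (v t) (z - x t) + κ * ‖v t‖ * ‖z - x t‖ ^ 2 := by
  have hxb : Bornology.IsBounded (range x) :=
    (isBounded_iff_forall_norm_le).2 ⟨D, by rintro _ ⟨t, rfl⟩; exact hxD t⟩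
  have hxi : Integrable x ν :=
    (integrable_const D).mono' hxm.aestronglyMeasurable (ae_of_all _ hxD)
  set N := {t | ¬ ∀ z ∈ C t, 0 ≤ inner ℝ (v t) (z - x t) + κ * ‖v t‖ * ‖z - x t‖ ^ 2} with hN
  change ν N = 0
  refine le_antisymm (ENNReal.le_of_forall_pos_le_add fun ε hε _ => ?_) zero_le
  have hε2 : 0 < (ε : ℝ≥0∞) / 2 := ENNReal.half_pos (by exact_mod_cast hε.ne')
  obtain ⟨K, hKc, hK, hxK⟩ := exists_isCompact_continuousOn hxi hε2
  obtain ⟨K', hKc', hK', hvK⟩ := exists_isCompact_continuousOn hv hε2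
  have hnull : ν (N ∩ (K ∩ K')) = 0 := by
    -- The null set depends on `w`, so no union over selections is taken. A violation at `t₀`
    -- extends to a continuous selection and, `x` and `v` being continuous on `K ∩ K'`, persists
    -- nearby in that set, where it can hold only on a null set.
    refine measure_null_of_locally_null _ fun t₀ ht₀ => ?_
    obtain ⟨z, hz, hneg⟩ : ∃ z ∈ C t₀,
        inner ℝ (v t₀) (z - x t₀) + κ * ‖v t₀‖ * ‖z - x t₀‖ ^ 2 < 0 := by
      simpa [hN] using ht₀.1
    obtain ⟨R, -, hext⟩ := hC x hxb hxC (‖z - x t₀‖ + 1) (by positivity)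
    obtain ⟨w, hw, hwC, hwz, -⟩ := hext {t₀} (fun _ => z) isCompact_singleton continuousOn_const
      (by simpa using hz) (by simp)
    have hwz' : w t₀ = z := hwz rfl
    have hae := ae_nonneg_of_continuous_selection hC hκ hxm hxD hxC hv hJ hw hwC
    have hct : ContinuousWithinAt
        (fun t => inner ℝ (v t) (w t - x t) + κ * ‖v t‖ * ‖w t - x t‖ ^ 2) (K ∩ K') t₀ := by
      have hxt : ContinuousWithinAt x (K ∩ K') t₀ := (hxK t₀ ht₀.2.1).mono inter_subset_left
      have hvt : ContinuousWithinAt v (K ∩ K') t₀ := (hvK t₀ ht₀.2.2).mono inter_subset_right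
      have hd := hw.continuousWithinAt.sub hxt
      exact (hvt.inner hd).add ((continuousWithinAt_const.mul hvt.norm).mul (hd.norm.pow 2))
    have hev : ∀ᶠ t in 𝓝[K ∩ K'] t₀,
        inner ℝ (v t) (w t - x t) + κ * ‖v t‖ * ‖w t - x t‖ ^ 2 < 0 := by
      refine hct.eventually_lt_const ?_
      simpa only [hwz'] using hneg
    refine ⟨_, nhdsWithin_mono _ inter_subset_right hev, ?_⟩
    refine measure_mono_null (fun t ht => ?_) (ae_iff.1 hae)
    exact not_le.2 ht
  have hsub : N ⊆ N ∩ (K ∩ K') ∪ (Kᶜ ∪ K'ᶜ) := fun t ht => by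
    by_cases h1 : t ∈ K <;> by_cases h2 : t ∈ K' <;> simp [ht, h1, h2]
  calc ν N ≤ ν (N ∩ (K ∩ K')) + (ν Kᶜ + ν K'ᶜ) :=
        (measure_mono hsub).trans ((measure_union_le _ _).trans
          (add_le_add le_rfl (measure_union_le _ _)))
    _ ≤ 0 + (ε / 2 + ε / 2) := by rw [hnull]; gcongr
    _ = 0 + ε := by rw [ENNReal.add_halves]

/-- A trajectory satisfying the integral inequality solves the sweeping process in the sense of
differential measures. -/
theorem ae_neg_mem_proximalNormalCone [CompleteSpace H] (hT : 0 < T) {ρ : ℝ≥0∞}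
    {C : TimeInterval T → Set H} (hC : HasSelectionExtension C) {x₀ : H}
    {x v : TimeInterval T → H} (hx : IsAdmissible hT C x₀ x) (hd : IsDensity x ν v)
    (hJ : ∀ y ∈ testTrajectories C ν, 0 ≤ proxIntegral ρ ν x v y) :
    ∀ᵐ t ∂ν, -v t ∈ proximalNormalCone (C t) (x t) := by
  have hrep : ∀ t, x t = x₀ + ∫ s in Iic t, v s ∂ν := fun t => by
    rw [← hx.initial]
    exact hd.eq_add_setIntegral hT hx.rightContinuous hx.boundedVariation t
  obtain ⟨g, hgc, hgb, hgx⟩ := exists_continuous_tendsto_setIntegral_Iic hd.1 x₀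
  simp_rw [← hrep] at hgx
  have hxm : StronglyMeasurable x := stronglyMeasurable_of_tendsto atTop
    (fun k => (hgc k).stronglyMeasurable) (tendsto_pi_nhds.2 hgx)
  filter_upwards [ae_forall_mem_nonneg (κ := halfInv ρ) hC ENNReal.toReal_nonneg hxm
    (fun t => le_of_tendsto' (hgx t).norm fun k => hgb k t) hx.mem hd.1 hJ] with t ht
  -- The inequality holds on all of `C t`, so the radius `1` is arbitrary.
  refine mem_proximalNormalCone_iff.2 ⟨hx.mem t, halfInv ρ * ‖v t‖,
    mul_nonneg ENNReal.toReal_nonneg (norm_nonneg _), 1, one_pos, fun z hz _ => ?_⟩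
  rw [inner_neg_left]
  linarith [ht z hz]

end Localization

end Sweeping

theorem mainTheorem3 {H : Type*} [NormedAddCommGroup H] [InnerProductSpace ℝ H] [CompleteSpace H]
    {T : ℝ} (hT : 0 < T) (ρ : ℝ≥0∞) (hρ : 0 < ρ)
    (Cn : ℕ → Sweeping.TimeInterval T → Set H) (C : Sweeping.TimeInterval T → Set H)
    (hCn : ∀ n, Sweeping.IsMovingSet ρ (Cn n)) (hC : Sweeping.IsMovingSet ρ C)
    (ν : Measure (Sweeping.TimeInterval T)) [IsFiniteMeasure ν]
    (hSAP : Sweeping.SelectionApproximation Cn C ν)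
    (hOSC : Sweeping.OuterSemicontinuity Cn C)
    (x₀ : H) (xn : ℕ → Sweeping.TimeInterval T → H) (x : Sweeping.TimeInterval T → H)
    (hadm : ∀ n, Sweeping.IsAdmissible hT (Cn n) x₀ (xn n))
    (hac : ∀ n, VectorMeasure.AbsolutelyContinuous (Sweeping.differentialMeasure (xn n))
      ν.toENNRealVectorMeasure)
    (hunif : TendstoUniformly xn x atTop)
    (p : ℝ≥0∞) (hp : 1 < p)
    (hbdd : ∃ M : ℝ≥0, ∀ n, eLpNorm (Sweeping.density (xn n) ν) p ν ≤ M)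
    (hvar : ∀ g : Sweeping.TimeInterval T → ℝ, Continuous g →
      Tendsto (fun n => ∫ t, g t ∂(Sweeping.differentialMeasure (xn n)).variation) atTop
        (𝓝 (∫ t, g t ∂(Sweeping.differentialMeasure x).variation)))
    (hres : Tendsto (fun n => Sweeping.residual ρ (Cn n) ν (xn n)) atTop (𝓝 0)) :
    Sweeping.IsIntegralSolution hT ρ C x₀ x ∧
      Sweeping.IsDifferentialMeasureSolution hT C x₀ x := by
  obtain ⟨hx, v, hd, hJ⟩ := Sweeping.exists_density_of_tendsto_residual hT ρ hSAP hOSC hadm hac hunif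
    hp hbdd hvar hres
  exact ⟨⟨hx, ν, v, inferInstance, hd, hJ⟩, hx, ν, v, inferInstance, hd,
    Sweeping.ae_neg_mem_proximalNormalCone hT hC.selectionExtension hx hd hJ⟩
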